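/- Let $n\in\{2,3,4\}$. Let $J_\nu$ be the Bessel function of the first kind and, for $\eta\ge 0$ (by continuity at $\eta=0$), $$f_n(\eta)=\eta^{1-n}\int_0^\infty e^{-s^4}(\eta s)^{n/2}J_{\frac{n-2}{2}}(\eta s)\,ds .$$ Let $b(x,t)=\alpha_n t^{-n/4}f_n(|x|/t^{1/4})$, $t>0$, with $\alpha_n=(2\pi)^{-n/2}$, be the biharmonic heat kernel on $\mathbb R^n$ (the constant normalizes $\int_{\mathbb R^n} b(x,t)\,dx=1$), and for $(x_0,t_0)\in\mathbb R^n\times(0,\infty)$ let $B(x,t)=b(x-x_0,t_0-t)$, $t<t_0$, be the backwards kernel. For $R>0$ put $T_R=\mathbb R^n\times(t_0-16R^4,\,t_0-R^4)$ and $$\Psi(u,R,\varphi)=\tfrac12\int_{T_R}|\Delta u|^2B\varphi\,dx\,dt-\tfrac12\int_{T_R}|\nabla u|^2\,\Delta B\,\varphi\,dx\,dt ,$$ where $\nabla,\Delta$ act in $x$. A cut-off function is a $\phi\in C_c^\infty(\mathbb R^n)$ with $0\le\phi\le1$ and $\phi=1$ near $0$. Consider smooth solutions $u:\mathbb R^n\times[0,\infty)\to\mathbb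 R$ of $\partial_tu=-\Delta^2u$, $u(\cdot,0)=u_0$, such that for $l=1,2,3,4$ $$\int_{\mathbb R^n}|\nabla^lu(x,t)|^2dx<\infty\ \ (t\ge0)\qquad\text{and}\qquad\int_0^T\!\!\int_{\mathbb R^n}|\nabla^lu|^2\,dx\,dt<\infty\ \ (T>0).$$ There is a constant $C>0$ depending only on $n$ such that for every $R_0>0$ there is a cut-off function $\phi$, depending only on $n$ and $R_0$, with the following properties for all such $u$ and all $(x_0,t_0)\in\mathbb R^n\times(0,\infty)$, where $\varphi(x)=\phi(x-x_0)$ and $\bar R=\min\{t_0^{1/4}/2,1\}$. For $R_0\le R\le\bar R$ both integrals in the definition of $\Psi(u,R,\varphi)$ converge and both of its terms, $\tfrac12\int_{T_R}|\Delta u|^2B\varphi$ and $-\tfrac12\int_{T_R}|\nabla u|^2\Delta B\,\varphi$, are non-negative. Moreover: 1. If $2\le n\le3$, then for all $R_0\le R_1<R_2\le\bar R$ $$\Psi(u,R_1,\varphi)\le\Psi(u,R_2,\varphi)+C(R_2^3-R_1^3)\int_{\mathbb R^n}|\nabla\Delta u_0|^2dx+C(R_2-R_1)\int_{\mathbb R^n}|\nabla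 u_0|^2dx+C(R_2-R_1)\int_{\mathbb R^n}|\Delta u_0|^2dx ,$$ and $\Psi$ is a pre-entropy, that is: (i) $\Psi(u,R,\varphi)\ge0$ for $R_0\le R\le\bar R$, and $\Psi(u,R,\varphi)=\Psi(u_R,1,\varphi_R)$ for $0<R\le\bar R$, where $u_R(y,s)=u(x_0+R(y-x_0),t_0+R^4(s-t_0))$ and $\varphi_R(y)=\varphi(x_0+R(y-x_0))$; (ii) $\frac{d}{dR}\Psi(v,R,1)=0$ for $0<R<\bar R$ whenever $v$ is a shrinking soliton, i.e. a smooth solution of the equation on $\mathbb R^n\times[0,t_0)$ with $\nabla v\cdot(x-x_0)+4(t-t_0)\partial_tv=0$ for $0<t<t_0$; (iii) for all $R_0\le R_1<R_2\le\bar R$, $\Psi(u,R_1,\varphi)\le\Psi(u,R_2,\varphi)+C(R_2-R_1)E_0$, where $E_0=\tfrac12\int|\Delta u_0|^2+\int|\nabla u_0|^2+\int|\nabla\Delta u_0|^2$ (the general pre-entropy inequality $\Psi(u,R_1,\varphi)\le e^{c_1(R_2^{a}-R_1^{a})}\Psi(u,R_2,\varphi)+c_2(R_2^{b}-R_1^{b})E_0$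 with $c_1=0$, $c_2=C$, $a=b=1$). 2. If $n=4$, then for all $R_0\le R_1<R_2\le\bar R$ $$\Psi(u,R_1,\varphi)\le\Psi(u,R_2,\varphi)+C(R_2^2-R_1^2)\int_{\mathbb R^4}|\nabla\Delta u_0|^2dx+C(R_2-R_1)\int_{\mathbb R^4}|\nabla u_0|^2dx+C\Big(1+\frac1{R_0}\Big)(R_2-R_1)\int_{\mathbb R^4}|\Delta u_0|^2dx .$$ -/

import Mathlib

open MeasureTheory Set
open scoped ContDiff

noncomputable section

namespace Biheat

/-- The power series `P_α(x) = ∑ₘ (-1)ᵐ (x/2)²ᵐ / (m! Γ(α+m+1))` (absolutely convergent). -/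
def besselP (α x : ℝ) : ℝ :=
  ∑' m : ℕ, (-1) ^ m * (x / 2) ^ (2 * m) / (m.factorial * Real.Gamma (α + m + 1))

/-- The Bessel function of the first kind `J_α(x) = (x/2)^α P_α(x)`, for `x > 0`. -/
def besselJ (α x : ℝ) : ℝ := (x / 2) ^ α * besselP α x

/-- The radial profile `f_n` of the biharmonic heat kernel,
`f_n(η) = η^{1-n} ∫_0^∞ exp(-s⁴) (η s)^{n/2} J_{(n-2)/2}(η s) ds`.
The factors `η^{1-n}` and `(η s)^{n/2} (η s/2)^{(n-2)/2}` are multiplied out, so that the formula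
is also meaningful at `η = 0`; see `profile_eq_besselJ`. -/
def profile (n : ℕ) (η : ℝ) : ℝ :=
  2 ^ (1 - (n : ℝ) / 2) *
    ∫ s in Ioi (0 : ℝ), Real.exp (-s ^ 4) * s ^ ((n : ℝ) - 1) * besselP (((n : ℝ) - 2) / 2) (η * s)

theorem profile_eq_besselJ (n : ℕ) {η : ℝ} (hη : 0 < η) :
    profile n η = η ^ (1 - (n : ℝ)) *
      ∫ s in Ioi (0 : ℝ),
        Real.exp (-s ^ 4) * (η * s) ^ ((n : ℝ) / 2) * besselJ (((n : ℝ) - 2) / 2) (η * s) := by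
  unfold profile
  rw [← integral_const_mul, ← integral_const_mul]
  refine setIntegral_congr_fun measurableSet_Ioi fun s hs => ?_
  have hs : 0 < s := hs
  have h2 : (0 : ℝ) < 2 := by norm_num
  have hηs : 0 < η * s := mul_pos hη hs
  have key : η ^ (1 - (n : ℝ)) * ((η * s) ^ ((n : ℝ) / 2) * (η * s / 2) ^ (((n : ℝ) - 2) / 2))
      = 2 ^ (1 - (n : ℝ) / 2) * s ^ ((n : ℝ) - 1) := by
    rw [Real.div_rpow hηs.le h2.le, div_eq_mul_inv ((η * s) ^ (((n : ℝ) - 2) / 2)),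
      ← Real.rpow_neg h2.le, ← mul_assoc, ← mul_assoc, mul_assoc (η ^ (1 - (n : ℝ))),
      ← Real.rpow_add hηs]
    have e2 : (n : ℝ) / 2 + ((n : ℝ) - 2) / 2 = (n : ℝ) - 1 := by ring
    have e3 : -(((n : ℝ) - 2) / 2) = 1 - (n : ℝ) / 2 := by ring
    have e1 : 1 - (n : ℝ) + ((n : ℝ) - 1) = 0 := by ring
    rw [e2, e3, Real.mul_rpow hη.le hs.le, ← mul_assoc, ← Real.rpow_add hη, e1, Real.rpow_zero]
    ring
  simp only [besselJ]
  linear_combination (-(Real.exp (-s ^ 4) * besselP (((n : ℝ) - 2) / 2) (η * s))) * key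

/-- The normalization constant `α_n` of the biharmonic heat kernel. Since
`∫_{ℝⁿ} f_n(|y|) dy = (2π)^{n/2}`, it gives the kernel total mass one. -/
def normConst (n : ℕ) : ℝ := (2 * Real.pi) ^ (-((n : ℝ) / 2))

variable {n : ℕ}

/-- The biharmonic heat kernel `b(x,t) = α_n t^{-n/4} f_n(|x| / t^{1/4})`, for `t > 0`. -/
def kernel (x : EuclideanSpace ℝ (Fin n)) (t : ℝ) : ℝ :=
  normConst n * profile n (‖x‖ / t ^ ((1 : ℝ) / 4)) / t ^ ((n : ℝ) / 4)

/-- The backwards biharmonic heat kernel `B` concentrating at `(x₀, t₀)`, for `t < t₀`. -/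
def backwardKernel (x₀ : EuclideanSpace ℝ (Fin n)) (t₀ : ℝ) (x : EuclideanSpace ℝ (Fin n))
    (t : ℝ) : ℝ :=
  kernel (x - x₀) (t₀ - t)

/-- The horizontal layer `T_R(t₀) = ℝⁿ × (t₀ - 16 R⁴, t₀ - R⁴)`. -/
def layer (n : ℕ) (t₀ R : ℝ) : Set (EuclideanSpace ℝ (Fin n) × ℝ) :=
  univ ×ˢ Ioo (t₀ - 16 * R ^ 4) (t₀ - R ^ 4)

/-- The integrand `|Δu|² B φ` (spatial Laplacian). -/
def laplacianDensity (x₀ : EuclideanSpace ℝ (Fin n)) (t₀ : ℝ)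
    (u : EuclideanSpace ℝ (Fin n) → ℝ → ℝ) (φ : EuclideanSpace ℝ (Fin n) → ℝ)
    (p : EuclideanSpace ℝ (Fin n) × ℝ) : ℝ :=
  (Laplacian.laplacian (fun y => u y p.2) p.1) ^ 2 * backwardKernel x₀ t₀ p.1 p.2 * φ p.1

/-- The integrand `|∇u|² ΔB φ` (spatial derivatives). -/
def gradientDensity (x₀ : EuclideanSpace ℝ (Fin n)) (t₀ : ℝ)
    (u : EuclideanSpace ℝ (Fin n) → ℝ → ℝ) (φ : EuclideanSpace ℝ (Fin n) → ℝ)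
    (p : EuclideanSpace ℝ (Fin n) × ℝ) : ℝ :=
  ‖gradient (fun y => u y p.2) p.1‖ ^ 2 *
    Laplacian.laplacian (fun y => backwardKernel x₀ t₀ y p.2) p.1 * φ p.1

/-- `Ψ(u,R,φ) = ½ ∫_{T_R(t₀)} |Δu|² B φ dx dt - ½ ∫_{T_R(t₀)} |∇u|² ΔB φ dx dt`. -/
def Psi (x₀ : EuclideanSpace ℝ (Fin n)) (t₀ : ℝ) (u : EuclideanSpace ℝ (Fin n) → ℝ → ℝ) (R : ℝ)
    (φ : EuclideanSpace ℝ (Fin n) → ℝ) : ℝ :=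
  1 / 2 * (∫ p in layer n t₀ R, laplacianDensity x₀ t₀ u φ p) -
    1 / 2 * ∫ p in layer n t₀ R, gradientDensity x₀ t₀ u φ p

/-- `u` is a smooth solution of `∂ₜu = -Δ²u` on `ℝⁿ × J`, where `J` is an interval
(smooth up to those end points that belong to `J`, with one-sided time derivatives there). -/
structure IsSolution (u : EuclideanSpace ℝ (Fin n) → ℝ → ℝ) (J : Set ℝ) : Prop where
  smooth : ContDiffOn ℝ ∞ (fun p : EuclideanSpace ℝ (Fin n) × ℝ => u p.1 p.2) (univ ×ˢ J)
  equation : ∀ x, ∀ t ∈ J, HasDerivWithinAt (fun s => u x s)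
    (-Laplacian.laplacian (Laplacian.laplacian fun y => u y t) x) J t

/-- The bounds `∇ˡu ∈ L²`, `l = 1, …, 4`: at every time `t ≥ 0`, and locally in time. -/
structure HasL2Bounds (u : EuclideanSpace ℝ (Fin n) → ℝ → ℝ) : Prop where
  slice : ∀ l ∈ Finset.Icc 1 4, ∀ t : ℝ, 0 ≤ t →
    Integrable fun x => ‖iteratedFDeriv ℝ l (fun y => u y t) x‖ ^ 2
  local_in_time : ∀ l ∈ Finset.Icc 1 4, ∀ T : ℝ, 0 < T →
    IntegrableOn (fun p : EuclideanSpace ℝ (Fin n) × ℝ =>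
      ‖iteratedFDeriv ℝ l (fun y => u y p.2) p.1‖ ^ 2) (univ ×ˢ Ioo 0 T)

/-- A smooth cut-off function around the origin. -/
structure IsCutoff (φ : EuclideanSpace ℝ (Fin n) → ℝ) : Prop where
  smooth : ContDiff ℝ ∞ φ
  compact_support : HasCompactSupport φ
  nonneg : ∀ x, 0 ≤ φ x
  le_one : ∀ x, φ x ≤ 1
  eq_one_near : ∀ᶠ x in nhds 0, φ x = 1

/-- The parabolic rescaling `u_R` with respect to the centre `(x₀, t₀)`. -/
def rescale (x₀ : EuclideanSpace ℝ (Fin n)) (t₀ R : ℝ) (u : EuclideanSpace ℝ (Fin n) → ℝ → ℝ) :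
    EuclideanSpace ℝ (Fin n) → ℝ → ℝ :=
  fun y s => u (x₀ + R • (y - x₀)) (t₀ + R ^ 4 * (s - t₀))

/-- The rescaling `φ_R` of a function of `x` with respect to the centre `x₀`. -/
def rescaleSpace (x₀ : EuclideanSpace ℝ (Fin n)) (R : ℝ) (φ : EuclideanSpace ℝ (Fin n) → ℝ) :
    EuclideanSpace ℝ (Fin n) → ℝ :=
  fun y => φ (x₀ + R • (y - x₀))

/-- `Sol u = ∇u · (x - x₀) + 4 (t - t₀) ∂ₜu`. -/
def sol (x₀ : EuclideanSpace ℝ (Fin n)) (t₀ : ℝ) (u : EuclideanSpace ℝ (Fin n) → ℝ → ℝ)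
    (x : EuclideanSpace ℝ (Fin n)) (t : ℝ) : ℝ :=
  inner ℝ (gradient (fun y => u y t) x) (x - x₀) + 4 * (t - t₀) * deriv (fun s => u x s) t

/-- Shrinking solitons: solutions on `ℝⁿ × [0,t₀)` (possibly singular at `t₀`) with `Sol u = 0`. -/
structure IsShrinkingSoliton (x₀ : EuclideanSpace ℝ (Fin n)) (t₀ : ℝ)
    (u : EuclideanSpace ℝ (Fin n) → ℝ → ℝ) : Prop where
  solution : IsSolution u (Ico 0 t₀)
  sol_eq_zero : ∀ x, ∀ t ∈ Ioo 0 t₀, sol x₀ t₀ u x t = 0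

/-- The largest admissible radius `min {t₀^{1/4}/2, 1}`. -/
def maxRadius (t₀ : ℝ) : ℝ := min (t₀ ^ ((1 : ℝ) / 4) / 2) 1

/-- Both integrals over `T_R(t₀)` in the definition of `Ψ` converge, and both terms of `Ψ` are
non-negative, for `R₀ ≤ R ≤ min {t₀^{1/4}/2, 1}`. -/
def TermsNonneg (x₀ : EuclideanSpace ℝ (Fin n)) (t₀ : ℝ) (u : EuclideanSpace ℝ (Fin n) → ℝ → ℝ)
    (φ : EuclideanSpace ℝ (Fin n) → ℝ) (R₀ : ℝ) : Prop :=
  ∀ R, R₀ ≤ R → R ≤ maxRadius t₀ →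
    IntegrableOn (laplacianDensity x₀ t₀ u φ) (layer n t₀ R) ∧
    IntegrableOn (gradientDensity x₀ t₀ u φ) (layer n t₀ R) ∧
    0 ≤ 1 / 2 * (∫ p in layer n t₀ R, laplacianDensity x₀ t₀ u φ p) ∧
    0 ≤ -(1 / 2 * ∫ p in layer n t₀ R, gradientDensity x₀ t₀ u φ p)

/-- `Ψ` is a pre-entropy along `u`, for the weight `φ` and radii in `[R₀, min {t₀^{1/4}/2, 1}]`,
with constants `c₁, c₂`, exponents `a, b` and initial energy `E₀` in the monotonicity formula. -/
structure IsPreEntropy (x₀ : EuclideanSpace ℝ (Fin n)) (t₀ : ℝ)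
    (u : EuclideanSpace ℝ (Fin n) → ℝ → ℝ) (φ : EuclideanSpace ℝ (Fin n) → ℝ) (R₀ c₁ c₂ : ℝ)
    (a b : ℕ) (E₀ : ℝ) : Prop where
  nonneg : ∀ R, R₀ ≤ R → R ≤ maxRadius t₀ → 0 ≤ Psi x₀ t₀ u R φ
  scaling : ∀ R, 0 < R → R ≤ maxRadius t₀ →
    Psi x₀ t₀ u R φ = Psi x₀ t₀ (rescale x₀ t₀ R u) 1 (rescaleSpace x₀ R φ)
  soliton_critical : ∀ v, IsShrinkingSoliton x₀ t₀ v → ∀ R, 0 < R → R < maxRadius t₀ →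
    HasDerivAt (fun r => Psi x₀ t₀ v r fun _ => 1) 0 R
  monotone : ∀ R₁ R₂, R₀ ≤ R₁ → R₁ < R₂ → R₂ ≤ maxRadius t₀ →
    Psi x₀ t₀ u R₁ φ ≤
      Real.exp (c₁ * (R₂ ^ a - R₁ ^ a)) * Psi x₀ t₀ u R₂ φ + c₂ * (R₂ ^ b - R₁ ^ b) * E₀

/-- `∫ |∇w|²`. -/
def gradientEnergy (w : EuclideanSpace ℝ (Fin n) → ℝ) : ℝ := ∫ x, ‖gradient w x‖ ^ 2

/-- `∫ |Δw|²`. -/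
def laplacianEnergy (w : EuclideanSpace ℝ (Fin n) → ℝ) : ℝ := ∫ x, (Laplacian.laplacian w x) ^ 2

/-- `∫ |∇Δw|²`. -/
def gradLaplacianEnergy (w : EuclideanSpace ℝ (Fin n) → ℝ) : ℝ :=
  ∫ x, ‖gradient (Laplacian.laplacian w) x‖ ^ 2

end Biheat

end

noncomputable section

namespace Biheat

variable {n : ℕ}

/-! The cut-off may depend on `R₀`, and this freedom carries the proof; `Ψ` is never differentiated
in `R` to compare two radii. The profile is a power series in `η²` with coefficients of alternating
sign, so at the origin it is positive and its Laplacian is negative. By continuity both signs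
persist on a ball of radius `δ` (`exists_spaceProfile_bounds`). For `t ≤ t₀ - R₀⁴` put `c = (t₀ -
t)^{1/4} ≥ R₀`. A cut-off supported in `|x - x₀| ≤ r` with `r ≤ δ R₀` only sees `|x - x₀| / c ≤ δ`,
so both terms of `Ψ` are integrals of non-negative densities.

Non-negativity gives monotonicity up to an error: `T_{R₁}` is contained in the union of `T_{R₂}` and
the strip `t₀ - R₂⁴ ≤ t ≤ t₀ - R₁⁴`, so only the integral over the strip must be estimated
(`Psi_le_add`). Its slice at time `t` is at most a constant times `c^{-n} ∫|Δu|² + c^{-n-2}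
∫_{B_r}|∇u|²`. Both terms are brought to the order `c^{-3}`, because `∫ c^{-3} dt = 4 (R₂ - R₁)`.
For the first, the energy does not increase, and `c^{-n}` is at most `c^{-3}` if `n ≤ 3` and at most
`R₀^{-1} c^{-3}` if `n = 4`. For the second, the integral over `B_r` is `O(r)` times global energies
(`setIntegral_ball_sq_le`), and `r ≤ δ R₀^{n-1}` absorbs the surplus power of `c`. The terms with
`∇Δu₀` are non-negative and are simply added.

Energy decay holds because `∂ᵢu` and `Δu` solve the same equation, which is tested against cut-offs
varying ever more slowly (`EnergyClass.energy_le`). The scaling law is a change of variables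
(`Psi_scaling`). Solitons are invariant under the rescaling (`IsShrinkingSoliton.rescale_eq`), so
their `Ψ` is locally constant in `R`. -/

/-! ### Partial derivatives, gradient and Laplacian in coordinates. -/

/-- The `i`-th partial derivative. -/
def pd (i : Fin n) (f : EuclideanSpace ℝ (Fin n) → ℝ) : EuclideanSpace ℝ (Fin n) → ℝ :=
  fun x => fderiv ℝ f x (EuclideanSpace.single i 1)

theorem contDiff_pd {f : EuclideanSpace ℝ (Fin n) → ℝ} (hf : ContDiff ℝ ∞ f) (i : Fin n) :
    ContDiff ℝ ∞ (pd i f) := by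
  have h : ContDiff ℝ ∞ (fderiv ℝ f) := hf.fderiv_right (by simp)
  exact h.clm_apply contDiff_const

theorem norm_iteratedFDeriv_pd_le {f : EuclideanSpace ℝ (Fin n) → ℝ} (hf : ContDiff ℝ ∞ f)
    (i : Fin n) (l : ℕ) (x : EuclideanSpace ℝ (Fin n)) :
    ‖iteratedFDeriv ℝ l (pd i f) x‖ ≤ ‖iteratedFDeriv ℝ (l + 1) f x‖ := by
  have h : ContDiff ℝ ∞ (fderiv ℝ f) := hf.fderiv_right (by simp)
  rw [← norm_iteratedFDeriv_fderiv]
  let A := ContinuousLinearMap.apply ℝ ℝ (EuclideanSpace.single i (1 : ℝ))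
  have hA : ‖A‖ ≤ 1 := A.opNorm_le_bound zero_le_one fun L => by
    simpa [A] using L.le_opNorm (EuclideanSpace.single i (1 : ℝ))
  have := A.norm_iteratedFDeriv_comp_left (f := fderiv ℝ f) (x := x) (N := ∞) (n := l)
    h.contDiffAt (by exact_mod_cast le_top)
  refine this.trans ?_
  exact mul_le_of_le_one_left (norm_nonneg _) hA

theorem laplacian_eq_sum_pd {f : EuclideanSpace ℝ (Fin n) → ℝ} (hf : ContDiff ℝ ∞ f) :
    Laplacian.laplacian f = fun x => ∑ i, pd i (pd i f) x := by
  rw [InnerProductSpace.laplacian_eq_iteratedFDeriv_orthonormalBasis f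
    (EuclideanSpace.basisFun (Fin n) ℝ)]
  funext x
  refine Finset.sum_congr rfl fun i _ => ?_
  have h : Differentiable ℝ (fderiv ℝ f) :=
    (hf.fderiv_right (m := ∞) (by simp)).differentiable (by simp)
  rw [iteratedFDeriv_two_apply]
  unfold pd
  rw [fderiv_clm_apply (h x) (differentiableAt_const _)]
  simp

theorem pd_comm {f : EuclideanSpace ℝ (Fin n) → ℝ} (hf : ContDiff ℝ ∞ f) (i j : Fin n) :
    pd i (pd j f) = pd j (pd i f) := by
  funext x
  have h : Differentiable ℝ (fderiv ℝ f) :=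
    (hf.fderiv_right (m := ∞) (by simp)).differentiable (by simp)
  unfold pd
  rw [fderiv_clm_apply (h x) (differentiableAt_const _),
    fderiv_clm_apply (h x) (differentiableAt_const _)]
  have hs : IsSymmSndFDerivAt ℝ f x :=
    ContDiffAt.isSymmSndFDerivAt (n := ∞) hf.contDiffAt (by simp; exact WithTop.coe_le_coe.2 (le_top : (2 : ℕ∞) ≤ ⊤))
  simpa using hs.eq _ _

theorem norm_gradient_sq (f : EuclideanSpace ℝ (Fin n) → ℝ) (x : EuclideanSpace ℝ (Fin n)) :
    ‖gradient f x‖ ^ 2 = ∑ i, pd i f x ^ 2 := by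
  rw [EuclideanSpace.norm_sq_eq]
  refine Finset.sum_congr rfl fun i _ => ?_
  have : gradient f x i = pd i f x := by
    rw [pd, ← inner_gradient_left]
    rw [EuclideanSpace.inner_single_right]
    simp
  rw [this, Real.norm_eq_abs, sq_abs]

theorem norm_gradient (f : EuclideanSpace ℝ (Fin n) → ℝ) (x : EuclideanSpace ℝ (Fin n)) :
    ‖gradient f x‖ = ‖fderiv ℝ f x‖ := by
  rw [← toDual_gradient, LinearIsometryEquiv.norm_map]

theorem pd_sum {ι : Type*} (s : Finset ι) {f : ι → EuclideanSpace ℝ (Fin n) → ℝ}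
    (hf : ∀ j ∈ s, Differentiable ℝ (f j)) (i : Fin n) :
    pd i (fun x => ∑ j ∈ s, f j x) = fun x => ∑ j ∈ s, pd i (f j) x := by
  funext x
  unfold pd
  rw [fderiv_fun_sum fun j hj => (hf j hj) x]
  simp

theorem pd_mul {f g : EuclideanSpace ℝ (Fin n) → ℝ} (hf : Differentiable ℝ f)
    (hg : Differentiable ℝ g) (i : Fin n) :
    pd i (fun x => f x * g x) = fun x => f x * pd i g x + pd i f x * g x := by
  funext x
  unfold pd
  rw [fderiv_fun_mul (hf x) (hg x)]
  simp [mul_comm]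

theorem differentiable_of_smooth {f : EuclideanSpace ℝ (Fin n) → ℝ} (hf : ContDiff ℝ ∞ f) :
    Differentiable ℝ f := hf.differentiable (by simp)

theorem contDiff_laplacian {f : EuclideanSpace ℝ (Fin n) → ℝ} (hf : ContDiff ℝ ∞ f) :
    ContDiff ℝ ∞ (Laplacian.laplacian f) := by
  rw [laplacian_eq_sum_pd hf]
  exact ContDiff.sum fun i _ => contDiff_pd (contDiff_pd hf i) i

theorem pd_laplacian {f : EuclideanSpace ℝ (Fin n) → ℝ} (hf : ContDiff ℝ ∞ f) (i : Fin n) :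
    pd i (Laplacian.laplacian f) = Laplacian.laplacian (pd i f) := by
  rw [laplacian_eq_sum_pd hf, laplacian_eq_sum_pd (contDiff_pd hf i),
    pd_sum _ fun j _ => differentiable_of_smooth (contDiff_pd (contDiff_pd hf j) j)]
  funext x
  refine Finset.sum_congr rfl fun j _ => ?_
  rw [pd_comm (contDiff_pd hf j), pd_comm hf]

theorem abs_laplacian_le (f : EuclideanSpace ℝ (Fin n) → ℝ) (x : EuclideanSpace ℝ (Fin n)) :
    |Laplacian.laplacian f x| ≤ n * ‖iteratedFDeriv ℝ 2 f x‖ := by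
  rw [InnerProductSpace.laplacian_eq_iteratedFDeriv_orthonormalBasis f
    (EuclideanSpace.basisFun (Fin n) ℝ)]
  refine (Finset.abs_sum_le_sum_abs _ _).trans ?_
  have h : ∀ i ∈ (Finset.univ : Finset (Fin n)),
      |iteratedFDeriv ℝ 2 f x ![EuclideanSpace.basisFun (Fin n) ℝ i,
        EuclideanSpace.basisFun (Fin n) ℝ i]| ≤ ‖iteratedFDeriv ℝ 2 f x‖ := fun i _ => by
    refine ((iteratedFDeriv ℝ 2 f x).le_opNorm _).trans ?_
    simp [Fin.prod_univ_two]
  refine (Finset.sum_le_card_nsmul _ _ _ h).trans ?_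
  simp

/-! ### Functions of space and time -/

theorem contDiff_slice {u : EuclideanSpace ℝ (Fin n) → ℝ → ℝ} {J : Set ℝ}
    (hu : ContDiffOn ℝ ∞ (fun p : EuclideanSpace ℝ (Fin n) × ℝ => u p.1 p.2) (univ ×ˢ J))
    {t : ℝ} (ht : t ∈ J) : ContDiff ℝ ∞ fun y => u y t := by
  rw [← contDiffOn_univ]
  exact hu.comp (f := fun y => (y, t)) (contDiff_id.prodMk contDiff_const).contDiffOn
    fun y _ => ⟨mem_univ _, ht⟩

/-- Moving in space alone never leaves `ℝⁿ × J`, so the spatial derivative is read off from the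
derivative within that set. This yields joint smoothness of spatial derivatives up to the end points
of `J`. -/
theorem pd_eq_fderivWithin {u : EuclideanSpace ℝ (Fin n) → ℝ → ℝ} {J : Set ℝ}
    (hu : ContDiffOn ℝ ∞ (fun p : EuclideanSpace ℝ (Fin n) × ℝ => u p.1 p.2) (univ ×ˢ J))
    (i : Fin n) {p : EuclideanSpace ℝ (Fin n) × ℝ} (hp : p ∈ univ ×ˢ J) :
    pd i (fun y => u y p.2) p.1 =
      fderivWithin ℝ (fun p : EuclideanSpace ℝ (Fin n) × ℝ => u p.1 p.2) (univ ×ˢ J) p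
        (EuclideanSpace.single i 1, 0) := by
  have h1 := (hu.differentiableOn (by simp) p hp).hasFDerivWithinAt
  have h2 : HasFDerivWithinAt (fun y : EuclideanSpace ℝ (Fin n) => (y, p.2))
      ((ContinuousLinearMap.id ℝ _).prod 0) univ p.1 :=
    (hasFDerivWithinAt_id _ _).prodMk (hasFDerivWithinAt_const _ _ _)
  have h3 := (HasFDerivWithinAt.comp (x := p.1) (t := univ ×ˢ J) h1 h2
    fun y _ => ⟨mem_univ _, hp.2⟩).hasFDerivAt Filter.univ_mem
  unfold pd
  have h4 : fderiv ℝ (fun y => u y p.2) p.1 = _ := h3.fderiv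
  rw [h4]
  simp

theorem contDiffOn_pd {u : EuclideanSpace ℝ (Fin n) → ℝ → ℝ} {J : Set ℝ}
    (hJ : UniqueDiffOn ℝ J)
    (hu : ContDiffOn ℝ ∞ (fun p : EuclideanSpace ℝ (Fin n) × ℝ => u p.1 p.2) (univ ×ˢ J))
    (i : Fin n) :
    ContDiffOn ℝ ∞ (fun p : EuclideanSpace ℝ (Fin n) × ℝ => pd i (fun y => u y p.2) p.1)
      (univ ×ˢ J) := by
  have h := hu.fderivWithin (m := ∞) (uniqueDiffOn_univ.prod hJ) (by simp)
  exact (h.clm_apply (contDiffOn_const (c := (EuclideanSpace.single i (1 : ℝ), (0 : ℝ))))).congr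
    fun p hp => pd_eq_fderivWithin hu i hp

theorem contDiffOn_laplacian {u : EuclideanSpace ℝ (Fin n) → ℝ → ℝ} {J : Set ℝ}
    (hJ : UniqueDiffOn ℝ J)
    (hu : ContDiffOn ℝ ∞ (fun p : EuclideanSpace ℝ (Fin n) × ℝ => u p.1 p.2) (univ ×ˢ J)) :
    ContDiffOn ℝ ∞
      (fun p : EuclideanSpace ℝ (Fin n) × ℝ => Laplacian.laplacian (fun y => u y p.2) p.1)
      (univ ×ˢ J) := by
  refine (ContDiffOn.sum (s := Finset.univ) fun i _ =>
    contDiffOn_pd (u := fun x t => pd i (fun y => u y t) x) hJ (contDiffOn_pd hJ hu i) i).congr fun p hp => ?_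
  rw [laplacian_eq_sum_pd (contDiff_slice hu hp.2)]

/-- Interchange of `∂ₜ` and `∂ᵢ`, by symmetry of the second derivative of `u` on space-time at an
interior time. -/
theorem hasDerivAt_pd {u v : EuclideanSpace ℝ (Fin n) → ℝ → ℝ} {J : Set ℝ}
    (hu : ContDiffOn ℝ ∞ (fun p : EuclideanSpace ℝ (Fin n) × ℝ => u p.1 p.2) (univ ×ˢ J))
    {t : ℝ} (ht : J ∈ nhds t) (hv : ∀ x, HasDerivAt (u x) (v x t) t) (i : Fin n)
    (x : EuclideanSpace ℝ (Fin n)) :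
    HasDerivAt (fun s => pd i (fun y => u y s) x) (pd i (fun y => v y t) x) t := by
  set U : EuclideanSpace ℝ (Fin n) × ℝ → ℝ := fun p => u p.1 p.2 with hU
  have hmem : ∀ (y : EuclideanSpace ℝ (Fin n)) (s : ℝ), J ∈ nhds s → univ ×ˢ J ∈ nhds (y, s) := fun y s hs =>
    prod_mem_nhds Filter.univ_mem hs
  have hc : ContDiffAt ℝ ∞ U (x, t) := hu.contDiffAt (hmem x t ht)
  have hD : ∀ y s, J ∈ nhds s → HasFDerivAt U (fderiv ℝ U (y, s)) (y, s) := fun y s hs =>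
    ((hu.contDiffAt (hmem y s hs)).differentiableAt (by simp)).hasFDerivAt
  have hD2 : HasFDerivAt (fderiv ℝ U) (fderiv ℝ (fderiv ℝ U) (x, t)) (x, t) :=
    ((hc.fderiv_right (m := ∞) (by simp)).differentiableAt (by simp)).hasFDerivAt
  have hpd : ∀ s, J ∈ nhds s → ∀ y, pd i (fun y => u y s) y =
      fderiv ℝ U (y, s) (EuclideanSpace.single i 1, 0) := fun s hs y => by
    have := pd_eq_fderivWithin hu i (p := (y, s)) ⟨mem_univ _, mem_of_mem_nhds hs⟩
    rwa [fderivWithin_of_mem_nhds (hmem y s hs)] at this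
  have hvt : ∀ y, v y t = fderiv ℝ U (y, t) (0, 1) := fun y => by
    have h1 : HasDerivAt (fun s : ℝ => (y, s)) ((0 : EuclideanSpace ℝ (Fin n)), (1 : ℝ)) t :=
      (hasDerivAt_const _ _).prodMk (hasDerivAt_id _)
    exact (hv y).unique ((hD y t ht).comp_hasDerivAt t h1)
  have hev : ∀ᶠ s in nhds t, J ∈ nhds s := eventually_eventually_nhds.mpr ht
  have e1 : HasDerivAt (fun s => fderiv ℝ U (x, s) (EuclideanSpace.single i 1, 0))
      (fderiv ℝ (fderiv ℝ U) (x, t) (0, 1) (EuclideanSpace.single i 1, 0)) t := by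
    have h1 : HasDerivAt (fun s : ℝ => (x, s)) ((0 : EuclideanSpace ℝ (Fin n)), (1 : ℝ)) t :=
      (hasDerivAt_const _ _).prodMk (hasDerivAt_id _)
    have h2 := hD2.comp_hasDerivAt t h1
    simpa using h2.clm_apply (hasDerivAt_const t (EuclideanSpace.single i (1 : ℝ), (0 : ℝ)))
  have e2 : pd i (fun y => v y t) x =
      fderiv ℝ (fderiv ℝ U) (x, t) (EuclideanSpace.single i 1, 0) (0, 1) := by
    have h1 : HasFDerivAt (fun y : EuclideanSpace ℝ (Fin n) => (y, t))
        ((ContinuousLinearMap.id ℝ _).prod 0) x :=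
      (hasFDerivAt_id _).prodMk (hasFDerivAt_const _ _)
    have h2 := HasFDerivAt.comp (g := fderiv ℝ U) x hD2 h1
    have h3 := h2.clm_apply (hasFDerivAt_const ((0 : EuclideanSpace ℝ (Fin n)), (1 : ℝ)) x)
    have h4 : (fun y => v y t) = fun y => (fderiv ℝ U ∘ fun y => (y, t)) y (0, 1) :=
      funext hvt
    unfold pd
    rw [h4, h3.fderiv]
    simp
  have hs : IsSymmSndFDerivAt ℝ U (x, t) :=
    ContDiffAt.isSymmSndFDerivAt (n := ∞) hc (by simp; exact WithTop.coe_le_coe.2 (le_top : (2 : ℕ∞) ≤ ⊤))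
  rw [e2, hs.eq]
  exact e1.congr_of_eventuallyEq (hev.mono fun s h => hpd s h x)

/-! ### Solutions of the equation, a class stable under `∂ᵢ` and `Δ`. -/

/-- Smooth functions on `ℝⁿ × [0,∞)` solving the biharmonic heat equation for `t > 0`. -/
structure BiheatSol (w : EuclideanSpace ℝ (Fin n) → ℝ → ℝ) : Prop where
  smooth : ContDiffOn ℝ ∞ (fun p : EuclideanSpace ℝ (Fin n) × ℝ => w p.1 p.2) (univ ×ˢ Ici 0)
  equation : ∀ x, ∀ t, 0 < t → HasDerivAt (w x)
    (-Laplacian.laplacian (Laplacian.laplacian fun y => w y t) x) t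

theorem IsSolution.biheatSol {u : EuclideanSpace ℝ (Fin n) → ℝ → ℝ}
    (hu : IsSolution u (Ici 0)) : BiheatSol u where
  smooth := hu.smooth
  equation x t ht := (hu.equation x t ht.le).hasDerivAt (Ici_mem_nhds ht)

theorem BiheatSol.slice {w : EuclideanSpace ℝ (Fin n) → ℝ → ℝ} (hw : BiheatSol w) {t : ℝ}
    (ht : 0 ≤ t) : ContDiff ℝ ∞ fun y => w y t := contDiff_slice hw.smooth ht

theorem pd_neg (f : EuclideanSpace ℝ (Fin n) → ℝ) (i : Fin n) :
    pd i (fun x => -f x) = fun x => -pd i f x := by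
  funext x
  simp [pd, fderiv_fun_neg]

theorem BiheatSol.pd {w : EuclideanSpace ℝ (Fin n) → ℝ → ℝ} (hw : BiheatSol w) (i : Fin n) :
    BiheatSol fun x t => Biheat.pd i (fun y => w y t) x where
  smooth := contDiffOn_pd (uniqueDiffOn_Ici 0) hw.smooth i
  equation x t ht := by
    have h := hasDerivAt_pd (v := fun x t =>
      -Laplacian.laplacian (Laplacian.laplacian fun y => w y t) x) hw.smooth (Ici_mem_nhds ht)
      (fun x => hw.equation x t ht) i x
    rw [pd_neg, pd_laplacian (contDiff_laplacian (hw.slice ht.le)),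
      pd_laplacian (hw.slice ht.le)] at h
    exact h

theorem laplacian_sum {ι : Type*} (s : Finset ι) {f : ι → EuclideanSpace ℝ (Fin n) → ℝ}
    (hf : ∀ j ∈ s, ContDiff ℝ ∞ (f j)) :
    Laplacian.laplacian (fun x => ∑ j ∈ s, f j x) =
      fun x => ∑ j ∈ s, Laplacian.laplacian (f j) x := by
  rw [laplacian_eq_sum_pd (ContDiff.sum hf)]
  funext x
  rw [Finset.sum_congr rfl fun j hj => congrFun (laplacian_eq_sum_pd (hf j hj)) x,
    Finset.sum_comm]
  refine Finset.sum_congr rfl fun i _ => ?_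
  rw [pd_sum s fun j hj => differentiable_of_smooth (hf j hj),
    pd_sum s fun j hj => differentiable_of_smooth (contDiff_pd (hf j hj) i)]

theorem BiheatSol.laplacian {w : EuclideanSpace ℝ (Fin n) → ℝ → ℝ} (hw : BiheatSol w) :
    BiheatSol fun x t => Laplacian.laplacian (fun y => w y t) x where
  smooth := contDiffOn_laplacian (uniqueDiffOn_Ici 0) hw.smooth
  equation x t ht := by
    have h := HasDerivAt.fun_sum (u := Finset.univ) fun i _ => ((hw.pd i).pd i).equation x t ht
    have hsm : ∀ j ∈ (Finset.univ : Finset (Fin n)),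
        ContDiff ℝ ∞ (Biheat.pd j (Biheat.pd j fun y => w y t)) := fun j _ =>
      contDiff_pd (contDiff_pd (hw.slice ht.le) j) j
    have e : Laplacian.laplacian (Laplacian.laplacian
        fun y => Laplacian.laplacian (fun z => w z t) y) x
        = ∑ i, Laplacian.laplacian (Laplacian.laplacian
          (Biheat.pd i (Biheat.pd i fun y => w y t))) x := by
      rw [show (fun y => Laplacian.laplacian (fun z => w z t) y) = _ from
        laplacian_eq_sum_pd (hw.slice ht.le), laplacian_sum _ hsm,
        laplacian_sum _ fun j hj => contDiff_laplacian (hsm j hj)]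
    rw [e, ← Finset.sum_neg_distrib]
    refine h.congr_of_eventuallyEq ?_
    filter_upwards [lt_mem_nhds ht] with s hs
    rw [laplacian_eq_sum_pd (hw.slice hs.le)]

/-! ### Square integrability, and equality of the Hessian and Laplacian energies. -/

theorem integrable_mul_of_sq {f g : EuclideanSpace ℝ (Fin n) → ℝ} (hf : Continuous f)
    (hg : Continuous g) (hf2 : Integrable fun x => f x ^ 2) (hg2 : Integrable fun x => g x ^ 2) :
    Integrable fun x => f x * g x := by
  refine (hf2.add hg2).mono' (hf.mul hg).aestronglyMeasurable (.of_forall fun x => ?_)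
  rw [Real.norm_eq_abs, abs_le]
  simp only [Pi.add_apply]
  constructor <;> nlinarith [sq_nonneg (f x + g x), sq_nonneg (f x - g x), sq_nonneg (f x),
    sq_nonneg (g x)]

theorem integrable_sq_pd {f : EuclideanSpace ℝ (Fin n) → ℝ} (hf : ContDiff ℝ ∞ f) {l : ℕ}
    (h : Integrable fun x => ‖iteratedFDeriv ℝ (l + 1) f x‖ ^ 2) (i : Fin n) :
    Integrable fun x => ‖iteratedFDeriv ℝ l (pd i f) x‖ ^ 2 := by
  refine h.mono' ?_ (.of_forall fun x => ?_)
  · exact (((contDiff_pd hf i).continuous_iteratedFDeriv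
      (by exact_mod_cast le_top)).norm.pow 2).aestronglyMeasurable
  · rw [Real.norm_of_nonneg (by positivity)]
    gcongr
    exact norm_iteratedFDeriv_pd_le hf i l x

theorem integrable_sq_of_zero {f : EuclideanSpace ℝ (Fin n) → ℝ}
    (h : Integrable fun x => ‖iteratedFDeriv ℝ 0 f x‖ ^ 2) : Integrable fun x => f x ^ 2 := by
  simpa using h

/-- Integrate by parts twice: `∂ᵢ` is moved off one factor, then `∂ⱼ` off the other. The
intermediate product contains third derivatives, hence the range of `l`. -/
theorem integral_pd_pd_sq {f : EuclideanSpace ℝ (Fin n) → ℝ} (hf : ContDiff ℝ ∞ f)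
    (h : ∀ l ∈ Finset.Icc 1 3, Integrable fun x => ‖iteratedFDeriv ℝ l f x‖ ^ 2) (i j : Fin n) :
    ∫ x, pd i (pd j f) x ^ 2 = ∫ x, pd i (pd i f) x * pd j (pd j f) x := by
  have h1 : ∀ k, Integrable fun x => pd k f x ^ 2 := fun k =>
    integrable_sq_of_zero (integrable_sq_pd hf (h 1 (by simp)) k)
  have h2 : ∀ k m, Integrable fun x => pd k (pd m f) x ^ 2 := fun k m =>
    integrable_sq_of_zero (integrable_sq_pd (contDiff_pd hf m)
      (integrable_sq_pd hf (h 2 (by simp)) m) k)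
  have h3 : ∀ k m p, Integrable fun x => pd k (pd m (pd p f)) x ^ 2 := fun k m p =>
    integrable_sq_of_zero (integrable_sq_pd (contDiff_pd (contDiff_pd hf p) m)
      (integrable_sq_pd (contDiff_pd hf p) (integrable_sq_pd hf (h 3 (by simp)) p) m) k)
  have s1 := fun k => contDiff_pd hf k
  have s2 := fun k m => contDiff_pd (s1 m) k
  have s3 := fun k m p => contDiff_pd (s2 m p) k
  have A : ∫ x, pd i (pd j f) x * pd i (pd j f) x = -∫ x, pd i (pd i (pd j f)) x * pd j f x :=
    integral_mul_fderiv_eq_neg_fderiv_mul_of_integrable (v := EuclideanSpace.single i 1)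
      (integrable_mul_of_sq (s3 _ _ _).continuous (s1 _).continuous (h3 i i j) (h1 _))
      (integrable_mul_of_sq (s2 _ _).continuous (s2 _ _).continuous (h2 _ _) (h2 _ _))
      (integrable_mul_of_sq (s2 _ _).continuous (s1 _).continuous (h2 _ _) (h1 _))
      (fun x _ => differentiable_of_smooth (s2 _ _) x)
      (fun x _ => differentiable_of_smooth (s1 _) x)
  have B : ∫ x, pd j f x * pd j (pd i (pd i f)) x = -∫ x, pd j (pd j f) x * pd i (pd i f) x :=
    integral_mul_fderiv_eq_neg_fderiv_mul_of_integrable (v := EuclideanSpace.single j 1)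
      (integrable_mul_of_sq (s2 _ _).continuous (s2 _ _).continuous (h2 _ _) (h2 _ _))
      (integrable_mul_of_sq (s1 _).continuous (s3 _ _ _).continuous (h1 _) (h3 _ _ _))
      (integrable_mul_of_sq (s1 _).continuous (s2 _ _).continuous (h1 _) (h2 _ _))
      (fun x _ => differentiable_of_smooth (s1 _) x)
      (fun x _ => differentiable_of_smooth (s2 _ _) x)
  have e : pd j (pd i (pd i f)) = pd i (pd i (pd j f)) := by
    rw [pd_comm (s1 i) j i, pd_comm hf j i]
  simp only [sq]
  rw [A]
  rw [e] at B
  simp only [mul_comm (pd i (pd i (pd j f)) _), B, neg_neg, mul_comm (pd j (pd j f) _)]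

/-- For functions with three derivatives in `L²`, `∫ |∇²f|² = ∫ |Δf|²`. -/
theorem sum_integral_pd_pd_sq {f : EuclideanSpace ℝ (Fin n) → ℝ} (hf : ContDiff ℝ ∞ f)
    (h : ∀ l ∈ Finset.Icc 1 3, Integrable fun x => ‖iteratedFDeriv ℝ l f x‖ ^ 2) :
    ∑ j, ∑ i, ∫ x, pd i (pd j f) x ^ 2 = laplacianEnergy f := by
  have h2 : ∀ k m, Integrable fun x => pd k (pd m f) x ^ 2 := fun k m =>
    integrable_sq_of_zero (integrable_sq_pd (contDiff_pd hf m)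
      (integrable_sq_pd hf (h 2 (by simp)) m) k)
  have s2 := fun k m => contDiff_pd (contDiff_pd hf m) k
  have hi : ∀ i j, Integrable fun x => pd i (pd i f) x * pd j (pd j f) x := fun i j =>
    integrable_mul_of_sq (s2 _ _).continuous (s2 _ _).continuous (h2 _ _) (h2 _ _)
  unfold laplacianEnergy
  rw [laplacian_eq_sum_pd hf]
  simp only [sq (∑ _, _), Finset.sum_mul_sum]
  rw [integral_finsetSum _ fun i _ => integrable_finsetSum _ fun j _ => hi i j,
    Finset.sum_comm]
  refine Finset.sum_congr rfl fun i _ => ?_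
  rw [integral_finsetSum _ fun j _ => hi i j]
  exact Finset.sum_congr rfl fun j _ => integral_pd_pd_sq hf h i j

/-! ### The mass of a function on a small ball. -/

/-- The local estimate `∫_{B_r} w² ≤ 2 r (∫ w² + ∫ |∇w|²)` in dimension at least two. -/
theorem setIntegral_ball_sq_le (hn : 2 ≤ n) {w : EuclideanSpace ℝ (Fin n) → ℝ}
    (hw : ContDiff ℝ ∞ w) (h0 : Integrable fun x => w x ^ 2)
    (h1 : ∀ i, Integrable fun x => pd i w x ^ 2) (x₀ : EuclideanSpace ℝ (Fin n)) {r : ℝ}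
    (hr : 0 < r) :
    ∫ x in Metric.closedBall x₀ r, w x ^ 2 ≤
      2 * r * ((∫ x, w x ^ 2) + ∑ i, ∫ x, pd i w x ^ 2) := by
  -- `X = (x - x₀)/q` with `q² = r² + |x - x₀|²` is the radial unit field smoothed at scale `r`. It
  -- satisfies `|X| ≤ 1` and `div X = (n - |X|²)/q ≥ 1/q` for `n ≥ 2`, while `1/q ≥ 1/(2r)` on the
  -- ball. Integrating `div X · w²` by parts leaves `-2 ∫ w X·∇w`, controlled by the global norms.
  let Q : EuclideanSpace ℝ (Fin n) → ℝ := fun x => r ^ 2 + ‖x - x₀‖ ^ 2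
  let q : EuclideanSpace ℝ (Fin n) → ℝ := fun x => √(Q x)
  let X : Fin n → EuclideanSpace ℝ (Fin n) → ℝ := fun i x => (x i - x₀ i) * (q x)⁻¹
  have hQ : ∀ x, 0 < Q x := fun x => by positivity
  have hq : ∀ x, 0 < q x := fun x => Real.sqrt_pos.2 (hQ x)
  have hqr : ∀ x, r ≤ q x := fun x => Real.le_sqrt_of_sq_le (by simp only [Q]; nlinarith [sq_nonneg ‖x - x₀‖])
  have hqq : ∀ x, q x ^ 2 = Q x := fun x => Real.sq_sqrt (hQ x).le
  have hQs : ContDiff ℝ ∞ Q := contDiff_const.add ((contDiff_id.sub contDiff_const).norm_sq ℝ)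
  have hqs : ContDiff ℝ ∞ q := hQs.sqrt fun x => (hQ x).ne'
  have hqi : ContDiff ℝ ∞ fun x => (q x)⁻¹ := hqs.inv fun x => (hq x).ne'
  have hcs : ∀ i : Fin n, ContDiff ℝ ∞ fun x : EuclideanSpace ℝ (Fin n) => x i - x₀ i := fun i => by
    fun_prop
  have hX : ∀ i, ContDiff ℝ ∞ (X i) := fun i => (hcs i).mul hqi
  have hsum : ∀ x : EuclideanSpace ℝ (Fin n), ∑ i, (x i - x₀ i) ^ 2 = ‖x - x₀‖ ^ 2 := fun x => by
    rw [EuclideanSpace.norm_sq_eq]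
    simp
  have hpX : ∀ i x, pd i (X i) x = (q x)⁻¹ - (x i - x₀ i) ^ 2 * (q x)⁻¹ ^ 3 := fun i x => by
    have d1 : HasFDerivAt Q (2 • innerSL ℝ (x - x₀)) x := by
      have h : HasFDerivAt (fun y => y - x₀) (ContinuousLinearMap.id ℝ _) x :=
        (hasFDerivAt_id x).sub_const x₀
      simpa only [ContinuousLinearMap.comp_id] using h.norm_sq.const_add (r ^ 2)
    have d2 := (hasDerivAt_inv (hq x).ne').comp_hasFDerivAt x (d1.sqrt (hQ x).ne')
    have d3 : HasFDerivAt (fun y : EuclideanSpace ℝ (Fin n) => y i - x₀ i)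
        (EuclideanSpace.proj i : EuclideanSpace ℝ (Fin n) →L[ℝ] ℝ) x :=
      ((EuclideanSpace.proj i : EuclideanSpace ℝ (Fin n) →L[ℝ] ℝ).hasFDerivAt).sub_const _
    have d4 := d3.mul d2
    unfold pd
    rw [show fderiv ℝ (X i) x = _ from d4.fderiv]
    have := (hq x).ne'
    simp [EuclideanSpace.inner_single_right]
    rw [show √(Q x) = q x from rfl]
    field_simp
    ring
  have hXle : ∀ i x, X i x ^ 2 ≤ 1 := fun i x => by
    simp only [X]
    rw [mul_pow, inv_pow, ← div_eq_mul_inv, div_le_one (by have := hq x; positivity), hqq x]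
    have : (x i - x₀ i) ^ 2 ≤ ‖x - x₀‖ ^ 2 := by
      rw [← hsum]
      exact Finset.single_le_sum (f := fun i => (x i - x₀ i) ^ 2) (fun _ _ => sq_nonneg _)
        (Finset.mem_univ i)
    simp only [Q]; nlinarith
  have hXsum : ∀ x, ∑ i, X i x ^ 2 ≤ 1 := fun x => by
    simp only [X, mul_pow]
    rw [← Finset.sum_mul, hsum, inv_pow, ← div_eq_mul_inv,
      div_le_one (by have := hq x; positivity), hqq x]
    simp only [Q]; nlinarith
  have hpXle : ∀ i x, |pd i (X i) x| ≤ r⁻¹ := fun i x => by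
    have e : pd i (X i) x = (q x)⁻¹ * (1 - X i x ^ 2) := by
      rw [hpX]; simp only [X]; ring
    rw [e, abs_of_nonneg (mul_nonneg (inv_nonneg.2 (hq x).le) (by linarith [hXle i x]))]
    have h1 : (q x)⁻¹ ≤ r⁻¹ := inv_anti₀ hr (hqr x)
    have h2 : 0 < (q x)⁻¹ := inv_pos.2 (hq x)
    nlinarith [sq_nonneg (X i x)]
  have hdiv : ∀ x, (q x)⁻¹ ≤ ∑ i, pd i (X i) x := fun x => by
    have e : ∑ i, pd i (X i) x = (q x)⁻¹ * (n - ∑ i, X i x ^ 2) := by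
      simp only [hpX, X, mul_pow]
      rw [Finset.sum_sub_distrib, ← Finset.sum_mul, ← Finset.sum_mul]
      simp
      ring
    rw [e]
    have : (2 : ℝ) ≤ n := by exact_mod_cast hn
    have h2 : 0 < (q x)⁻¹ := inv_pos.2 (hq x)
    nlinarith [hXsum x]
  have hwc := hw.continuous
  have hww : Integrable fun x => w x * w x := by simpa [sq] using h0
  have hpd2 : ∀ i, pd i (fun x => w x * w x) = fun x => 2 * (w x * pd i w x) := fun i => by
    rw [pd_mul (differentiable_of_smooth hw) (differentiable_of_smooth hw)]
    funext x; ring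
  have i1 : ∀ i, Integrable fun x => pd i (X i) x * (w x * w x) := fun i =>
    hww.bdd_mul (contDiff_pd (hX i) i).continuous.aestronglyMeasurable
      (.of_forall fun x => hpXle i x)
  have i2 : ∀ i, Integrable fun x => X i x * pd i (fun x => w x * w x) x := fun i => by
    rw [hpd2]
    refine ((integrable_mul_of_sq hwc (contDiff_pd hw i).continuous h0 (h1 i)).const_mul 2).bdd_mul
      (c := 1) (hX i).continuous.aestronglyMeasurable (.of_forall fun x => ?_)
    rw [Real.norm_eq_abs]
    exact (sq_le_one_iff_abs_le_one _).1 (hXle i x)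
  have i3 : ∀ i, Integrable fun x => X i x * (w x * w x) := fun i => by
    refine hww.bdd_mul (c := 1) (hX i).continuous.aestronglyMeasurable (.of_forall fun x => ?_)
    rw [Real.norm_eq_abs]
    exact (sq_le_one_iff_abs_le_one _).1 (hXle i x)
  have ibp : ∀ i, ∫ x, X i x * pd i (fun x => w x * w x) x = -∫ x, pd i (X i) x * (w x * w x) :=
    fun i => integral_mul_fderiv_eq_neg_fderiv_mul_of_integrable
      (v := EuclideanSpace.single i 1) (i1 i) (i2 i) (i3 i)
      (fun x _ => differentiable_of_smooth (hX i) x)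
      (fun x _ => differentiable_of_smooth (hw.mul hw) x)
  have key : ∫ x, (∑ i, pd i (X i) x) * (w x * w x) ≤ (∫ x, w x ^ 2) + ∑ i, ∫ x, pd i w x ^ 2 := by
    simp only [Finset.sum_mul]
    rw [integral_finsetSum _ fun i _ => i1 i, ← integral_finsetSum _ fun i _ => h1 i,
      ← integral_add h0 (integrable_finsetSum _ fun i _ => h1 i)]
    have : ∀ i, ∫ x, pd i (X i) x * (w x * w x) = ∫ x, -(X i x * pd i (fun x => w x * w x) x) :=
      fun i => by rw [integral_neg, ibp, neg_neg]
    simp only [this]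
    have i2n : ∀ i, Integrable fun x => -(X i x * pd i (fun x => w x * w x) x) := fun i =>
      (i2 i).neg
    rw [← integral_finsetSum _ fun i _ => i2n i]
    refine integral_mono (integrable_finsetSum _ fun i _ => i2n i)
      (h0.add (integrable_finsetSum _ fun i _ => h1 i)) fun x => ?_
    simp only [hpd2]
    have a1 : ∀ i ∈ (Finset.univ : Finset (Fin n)),
        -(X i x * (2 * (w x * pd i w x))) ≤ X i x ^ 2 * w x ^ 2 + pd i w x ^ 2 := fun i _ => by
      nlinarith [sq_nonneg (X i x * w x + pd i w x)]
    refine (Finset.sum_le_sum a1).trans ?_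
    rw [Finset.sum_add_distrib, ← Finset.sum_mul]
    have := mul_le_mul_of_nonneg_right (hXsum x) (sq_nonneg (w x))
    linarith
  have iD : Integrable fun x => (∑ i, pd i (X i) x) * (w x * w x) := by
    simp only [Finset.sum_mul]
    exact integrable_finsetSum _ fun i _ => i1 i
  have hpt : ∀ x ∈ Metric.closedBall x₀ r,
      w x ^ 2 ≤ 2 * r * ((∑ i, pd i (X i) x) * (w x * w x)) := fun x hx => by
    have hx' : ‖x - x₀‖ ≤ r := by simpa [dist_eq_norm] using hx
    -- In fact `q ≤ √2 r` on the ball; the constant 2 avoids the root.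
    have hq2 : q x ≤ 2 * r := by
      refine Real.sqrt_le_iff.2 ⟨by positivity, ?_⟩
      simp only [Q]
      nlinarith [norm_nonneg (x - x₀)]
    have h3 : 1 ≤ 2 * r * (q x)⁻¹ := by
      rw [← div_eq_mul_inv, one_le_div (hq x)]; exact hq2
    have h4 : 1 ≤ 2 * r * ∑ i, pd i (X i) x :=
      h3.trans (mul_le_mul_of_nonneg_left (hdiv x) (by positivity))
    calc w x ^ 2 = 1 * (w x * w x) := by ring
      _ ≤ (2 * r * ∑ i, pd i (X i) x) * (w x * w x) :=
        mul_le_mul_of_nonneg_right h4 (mul_self_nonneg _)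
      _ = _ := by ring
  calc ∫ x in Metric.closedBall x₀ r, w x ^ 2
      ≤ ∫ x in Metric.closedBall x₀ r, 2 * r * ((∑ i, pd i (X i) x) * (w x * w x)) :=
        setIntegral_mono_on h0.integrableOn (iD.const_mul _).integrableOn
          Metric.isClosed_closedBall.measurableSet hpt
    _ ≤ ∫ x, 2 * r * ((∑ i, pd i (X i) x) * (w x * w x)) := by
        refine setIntegral_le_integral (iD.const_mul _) (.of_forall fun x => ?_)
        have := (inv_pos.2 (hq x)).le.trans (hdiv x)
        have := mul_self_nonneg (w x)
        simp only [Pi.zero_apply]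
        positivity
    _ ≤ _ := by
        rw [integral_const_mul]
        exact mul_le_mul_of_nonneg_left key (by positivity)

/-! ### Cut-offs at infinity -/

theorem pd_comp_smul {f : EuclideanSpace ℝ (Fin n) → ℝ} (hf : Differentiable ℝ f) (c : ℝ)
    (i : Fin n) : pd i (fun x => f (c • x)) = fun x => c * pd i f (c • x) := by
  funext x
  have h : HasFDerivAt (fun y : EuclideanSpace ℝ (Fin n) => c • y)
      (c • ContinuousLinearMap.id ℝ (EuclideanSpace ℝ (Fin n))) x := (hasFDerivAt_id x).const_smul c
  have h2 := HasFDerivAt.comp (g := f) x (hf (c • x)).hasFDerivAt h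
  unfold pd
  rw [show fderiv ℝ (fun x => f (c • x)) x = _ from h2.fderiv]
  simp

theorem hasCompactSupport_pd {f : EuclideanSpace ℝ (Fin n) → ℝ} (hf : HasCompactSupport f)
    (i : Fin n) : HasCompactSupport (pd i f) :=
  hf.fderiv_apply (𝕜 := ℝ) (EuclideanSpace.single i 1)

/-- One bump function, dilated by `ρ`. Second derivatives are of order `ρ⁻²`, weakened to `ρ⁻¹` by
`ρ ≥ 1`, so that a single small number controls both orders. -/
theorem exists_cutoff_slowly_varying (n : ℕ) : ∃ C : ℝ, 0 ≤ C ∧ ∀ ρ : ℝ, 1 ≤ ρ →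
    ∃ ζ : EuclideanSpace ℝ (Fin n) → ℝ, ContDiff ℝ ∞ ζ ∧ HasCompactSupport ζ ∧ (∀ x, 0 ≤ ζ x) ∧
      (∀ x, ζ x ≤ 1) ∧ (∀ x, ‖x‖ ≤ ρ → ζ x = 1) ∧ (∀ i x, |pd i ζ x| ≤ C / ρ) ∧
      ∀ i x, |pd i (pd i ζ) x| ≤ C / ρ := by
  let χ : ContDiffBump (0 : EuclideanSpace ℝ (Fin n)) := ⟨1, 2, one_pos, one_lt_two⟩
  have hχ : ContDiff ℝ ∞ χ := χ.contDiff
  have hχc : HasCompactSupport χ := χ.hasCompactSupport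
  have b1 : ∀ i, ∃ C, ∀ x, ‖pd i χ x‖ ≤ C := fun i =>
    (hasCompactSupport_pd hχc i).exists_bound_of_continuous (contDiff_pd hχ i).continuous
  have b2 : ∀ i, ∃ C, ∀ x, ‖pd i (pd i χ) x‖ ≤ C := fun i =>
    (hasCompactSupport_pd (hasCompactSupport_pd hχc i) i).exists_bound_of_continuous
      (contDiff_pd (contDiff_pd hχ i) i).continuous
  choose C1 hC1 using b1
  choose C2 hC2 using b2
  have p1 : ∀ i, 0 ≤ C1 i := fun i => (norm_nonneg _).trans (hC1 i 0)
  have p2 : ∀ i, 0 ≤ C2 i := fun i => (norm_nonneg _).trans (hC2 i 0)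
  have hC : ∀ i, C1 i + C2 i ≤ ∑ i, (C1 i + C2 i) := fun i =>
    Finset.single_le_sum (f := fun i => C1 i + C2 i) (fun j _ => add_nonneg (p1 j) (p2 j))
      (Finset.mem_univ i)
  refine ⟨∑ i, (C1 i + C2 i), Finset.sum_nonneg fun i _ => add_nonneg (p1 i) (p2 i),
    fun ρ hρ => ?_⟩
  have hρ0 : 0 < ρ := by linarith
  have hinv : ρ⁻¹ ≤ 1 := inv_le_one_of_one_le₀ hρ
  have hinv0 : 0 < ρ⁻¹ := inv_pos.2 hρ0
  refine ⟨fun x => χ (ρ⁻¹ • x), hχ.comp (contDiff_const_smul _), ?_, fun x => χ.nonneg,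
    fun x => χ.le_one, fun x hx => ?_, fun i x => ?_, fun i x => ?_⟩
  · exact hχc.comp_homeomorph (Homeomorph.smulOfNeZero ρ⁻¹ hinv0.ne')
  · refine χ.one_of_mem_closedBall ?_
    rw [mem_closedBall_zero_iff, norm_smul, Real.norm_of_nonneg hinv0.le]
    calc ρ⁻¹ * ‖x‖ ≤ ρ⁻¹ * ρ := by gcongr
      _ = 1 := inv_mul_cancel₀ hρ0.ne'
  · rw [pd_comp_smul (differentiable_of_smooth hχ), abs_mul, abs_of_pos hinv0, div_eq_inv_mul]
    gcongr
    exact (hC1 i _).trans ((le_add_of_nonneg_right (p2 i)).trans (hC i))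
  · rw [pd_comp_smul (differentiable_of_smooth hχ)]
    have h2 : pd i (fun x => ρ⁻¹ * pd i χ (ρ⁻¹ • x)) =
        fun x => ρ⁻¹ * (ρ⁻¹ * pd i (pd i χ) (ρ⁻¹ • x)) := by
      have hd := differentiable_of_smooth (contDiff_pd hχ i)
      have hd2 : Differentiable ℝ fun x => pd i χ (ρ⁻¹ • x) :=
        hd.comp (f := fun x => ρ⁻¹ • x) (by fun_prop)
      rw [pd_mul (differentiable_const _) hd2, pd_comp_smul hd]
      funext x
      simp [pd]
    rw [h2, abs_mul, abs_mul, abs_of_pos hinv0, div_eq_inv_mul]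
    gcongr
    calc ρ⁻¹ * |pd i (pd i χ) (ρ⁻¹ • x)| ≤ 1 * |pd i (pd i χ) (ρ⁻¹ • x)| := by gcongr
      _ ≤ _ := by
        rw [one_mul]
        exact (hC2 i _).trans ((le_add_of_nonneg_left (p1 i)).trans (hC i))

/-! ### Energy estimates -/

theorem integral_mul_laplacian {f g : EuclideanSpace ℝ (Fin n) → ℝ} (hf : ContDiff ℝ ∞ f)
    (hfc : HasCompactSupport f) (hg : ContDiff ℝ ∞ g) :
    ∫ x, f x * Laplacian.laplacian g x = ∫ x, Laplacian.laplacian f x * g x := by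
  have hi : ∀ {a b : EuclideanSpace ℝ (Fin n) → ℝ}, ContDiff ℝ ∞ a → HasCompactSupport a →
      ContDiff ℝ ∞ b → Integrable fun x => a x * b x := fun ha hac hb =>
    (ha.continuous.mul hb.continuous).integrable_of_hasCompactSupport hac.mul_right
  have ibp : ∀ {a b : EuclideanSpace ℝ (Fin n) → ℝ}, ContDiff ℝ ∞ a → HasCompactSupport a →
      ContDiff ℝ ∞ b → ∀ i, ∫ x, a x * pd i b x = -∫ x, pd i a x * b x := fun ha hac hb i =>
    integral_mul_fderiv_eq_neg_fderiv_mul_of_integrable (v := EuclideanSpace.single i 1)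
      (hi (contDiff_pd ha i) (hasCompactSupport_pd hac i) hb) (hi ha hac (contDiff_pd hb i))
      (hi ha hac hb) (fun x _ => differentiable_of_smooth ha x)
      (fun x _ => differentiable_of_smooth hb x)
  rw [laplacian_eq_sum_pd hf, laplacian_eq_sum_pd hg]
  simp only [Finset.mul_sum, Finset.sum_mul]
  rw [integral_finsetSum _ fun i _ => hi hf hfc (contDiff_pd (contDiff_pd hg i) i),
    integral_finsetSum _ fun i _ => hi (contDiff_pd (contDiff_pd hf i) i)
      (hasCompactSupport_pd (hasCompactSupport_pd hfc i) i) hg]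
  refine Finset.sum_congr rfl fun i _ => ?_
  rw [ibp hf hfc (contDiff_pd hg i) i,
    ibp (contDiff_pd hf i) (hasCompactSupport_pd hfc i) hg i, neg_neg]

theorem pd_add {f g : EuclideanSpace ℝ (Fin n) → ℝ} (hf : Differentiable ℝ f)
    (hg : Differentiable ℝ g) (i : Fin n) :
    pd i (fun x => f x + g x) = fun x => pd i f x + pd i g x := by
  funext x
  unfold pd
  rw [fderiv_fun_add (hf x) (hg x)]
  simp

theorem laplacian_mul {f g : EuclideanSpace ℝ (Fin n) → ℝ} (hf : ContDiff ℝ ∞ f)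
    (hg : ContDiff ℝ ∞ g) (x : EuclideanSpace ℝ (Fin n)) :
    Laplacian.laplacian (fun x => f x * g x) x =
      f x * Laplacian.laplacian g x + ∑ i, (2 * (pd i f x * pd i g x) + pd i (pd i f) x * g x) := by
  rw [laplacian_eq_sum_pd (hf.mul hg), laplacian_eq_sum_pd hg, Finset.mul_sum,
    ← Finset.sum_add_distrib]
  refine Finset.sum_congr rfl fun i _ => ?_
  have df := differentiable_of_smooth hf
  have dg := differentiable_of_smooth hg
  have df' := differentiable_of_smooth (contDiff_pd hf i)
  have dg' := differentiable_of_smooth (contDiff_pd hg i)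
  rw [pd_mul df dg, pd_add (df.fun_mul dg') (df'.fun_mul dg), pd_mul df dg', pd_mul df' dg]
  ring

/-- The density `g² + |∇g|² + |Δg|²`. -/
def sobolevDensity (g : EuclideanSpace ℝ (Fin n) → ℝ) (x : EuclideanSpace ℝ (Fin n)) : ℝ :=
  g x ^ 2 + ∑ i, pd i g x ^ 2 + Laplacian.laplacian g x ^ 2

/-- Moving one Laplacian over gives `-∫ Δ(ζg) Δg`. The part `-∫ ζ|Δg|²` has a good sign and is
dropped; every other term contains a derivative of `ζ`, hence a factor `ε`, and is split by Young's
inequality. -/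
theorem neg_integral_mul_bilaplacian_le {ζ g : EuclideanSpace ℝ (Fin n) → ℝ}
    (hζ : ContDiff ℝ ∞ ζ) (hζc : HasCompactSupport ζ) (hζ0 : ∀ x, 0 ≤ ζ x) {ε : ℝ}
    (hζ1 : ∀ i x, |pd i ζ x| ≤ ε) (hζ2 : ∀ i x, |pd i (pd i ζ) x| ≤ ε)
    (hg : ContDiff ℝ ∞ g) (hM : Integrable (sobolevDensity g)) (hε : 0 ≤ ε) :
    ∫ x, ζ x * g x * -Laplacian.laplacian (Laplacian.laplacian g) x ≤
      ε * (2 * n + 1) * ∫ x, sobolevDensity g x := by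
  have hL := contDiff_laplacian hg
  have hζg : ContDiff ℝ ∞ fun x => ζ x * g x := hζ.mul hg
  have hζgc : HasCompactSupport fun x => ζ x * g x := hζc.mul_right
  simp only [mul_neg]
  rw [integral_neg, integral_mul_laplacian hζg hζgc hL, ← integral_neg, ← integral_const_mul]
  have hsupp : HasCompactSupport fun x => Laplacian.laplacian (fun x => ζ x * g x) x := by
    rw [laplacian_eq_sum_pd hζg]
    refine HasCompactSupport.of_support_subset_isCompact hζgc.isCompact fun x hx => ?_
    by_contra hx'
    refine hx (Finset.sum_eq_zero fun i _ => ?_)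
    refine image_eq_zero_of_notMem_tsupport fun h => hx' ?_
    exact (tsupport_fderiv_apply_subset ℝ _).trans (tsupport_fderiv_apply_subset ℝ _) h
  refine integral_mono ?_ (hM.const_mul _) fun x => ?_
  · exact (((contDiff_laplacian hζg).continuous.mul
      hL.continuous).integrable_of_hasCompactSupport hsupp.mul_right).neg
  · simp only
    rw [laplacian_mul hζ hg]
    set L := Laplacian.laplacian g x with hLdef
    have hterm : ∀ i ∈ (Finset.univ : Finset (Fin n)),
        -((2 * (pd i ζ x * pd i g x) + pd i (pd i ζ) x * g x) * L) ≤
          ε * (pd i g x ^ 2 + g x ^ 2 + 2 * L ^ 2) := fun i _ => by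
      have b1 : -(pd i ζ x * (2 * (pd i g x * L))) ≤ ε * (pd i g x ^ 2 + L ^ 2) := by
        have h1 : |2 * (pd i g x * L)| ≤ pd i g x ^ 2 + L ^ 2 := abs_le.2
          ⟨by nlinarith [sq_nonneg (pd i g x + L)], by nlinarith [sq_nonneg (pd i g x - L)]⟩
        calc -(pd i ζ x * (2 * (pd i g x * L))) ≤ |pd i ζ x * (2 * (pd i g x * L))| :=
              neg_le_abs _
          _ ≤ _ := by rw [abs_mul]; exact mul_le_mul (hζ1 i x) h1 (abs_nonneg _) hε
      have b2 : -(pd i (pd i ζ) x * (g x * L)) ≤ ε * (g x ^ 2 + L ^ 2) := by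
        have h1 : |g x * L| ≤ g x ^ 2 + L ^ 2 := abs_le.2
          ⟨by nlinarith [sq_nonneg (g x + L), sq_nonneg (g x), sq_nonneg L],
            by nlinarith [sq_nonneg (g x - L), sq_nonneg (g x), sq_nonneg L]⟩
        calc -(pd i (pd i ζ) x * (g x * L)) ≤ |pd i (pd i ζ) x * (g x * L)| := neg_le_abs _
          _ ≤ _ := by rw [abs_mul]; exact mul_le_mul (hζ2 i x) h1 (abs_nonneg _) hε
      linarith
    have hs := Finset.sum_le_sum hterm
    rw [← Finset.mul_sum, Finset.sum_add_distrib, Finset.sum_add_distrib] at hs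
    rw [Finset.sum_neg_distrib, ← Finset.sum_mul] at hs
    simp only [Finset.sum_const, Finset.card_univ, Fintype.card_fin, nsmul_eq_mul] at hs
    have hζL : 0 ≤ ζ x * L * L := by nlinarith [mul_nonneg (hζ0 x) (mul_self_nonneg L)]
    rw [add_mul]
    have hS : 0 ≤ ∑ i, pd i g x ^ 2 := Finset.sum_nonneg fun i _ => sq_nonneg _
    simp only [sobolevDensity]
    have q1 : 0 ≤ ε * (n + 1) * g x ^ 2 := by positivity
    have q2 : 0 ≤ ε * (2 * n) * ∑ i, pd i g x ^ 2 := by positivity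
    have q3 : 0 ≤ ε * L ^ 2 := by positivity
    linarith

/-- Solutions `w` for which `w`, `∇w` and `Δw` are square integrable in space and time. -/
structure EnergyClass (w : EuclideanSpace ℝ (Fin n) → ℝ → ℝ) : Prop extends BiheatSol w where
  slice_sq : ∀ t, 0 ≤ t → Integrable fun x => w x t ^ 2
  density : ∀ T : ℝ, 0 < T → IntegrableOn (fun p : EuclideanSpace ℝ (Fin n) × ℝ =>
    sobolevDensity (fun y => w y p.2) p.1) (univ ×ˢ Ioo 0 T)

/-- The fundamental theorem of calculus is applied in time at each fixed `x`, and Fubini then brings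
in the spatial estimate; this replaces differentiation under the integral sign. -/
theorem EnergyClass.cutoff_energy_le {w : EuclideanSpace ℝ (Fin n) → ℝ → ℝ} (hw : EnergyClass w)
    {ζ : EuclideanSpace ℝ (Fin n) → ℝ}
    (hζ : ContDiff ℝ ∞ ζ) (hζc : HasCompactSupport ζ) (hζ0 : ∀ x, 0 ≤ ζ x) {ε : ℝ}
    (hζ1 : ∀ i x, |pd i ζ x| ≤ ε) (hζ2 : ∀ i x, |pd i (pd i ζ) x| ≤ ε) (hε : 0 ≤ ε) {t : ℝ}
    (ht : 0 < t) :
    ∫ x, ζ x * w x t ^ 2 ≤ (∫ x, ζ x * w x 0 ^ 2) +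
      ε * (2 * (2 * n + 1) * ∫ p in univ ×ˢ Ioo 0 t,
        sobolevDensity (fun y => w y (Prod.snd p)) (Prod.fst p)) := by
  let H : EuclideanSpace ℝ (Fin n) × ℝ → ℝ := fun p => 2 * (ζ p.1 * w p.1 p.2 *
    -Laplacian.laplacian (Laplacian.laplacian fun y => w y p.2) p.1)
  have hU := uniqueDiffOn_Ici (0 : ℝ)
  have hLL := contDiffOn_laplacian (u := fun x t => Laplacian.laplacian (fun y => w y t) x) hU
    (contDiffOn_laplacian hU hw.smooth)
  have hH : ContinuousOn H (univ ×ˢ Ici 0) :=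
    (((hζ.continuous.comp continuous_fst).continuousOn.mul hw.smooth.continuousOn).mul
      hLL.continuousOn.neg).const_smul (2 : ℝ)
  -- The factor `ζ` confines `H` to a compact set of space-time, so no decay of `Δ²w` enters.
  have hHi : IntegrableOn H (univ ×ˢ Ioo 0 t) := by
    have h1 : IntegrableOn H (tsupport ζ ×ˢ Icc 0 t) :=
      (hH.mono (prod_mono (subset_univ _) Icc_subset_Ici_self)).integrableOn_compact
        (hζc.isCompact.prod isCompact_Icc)
    refine IntegrableOn.of_forall_sdiff_eq_zero h1 (MeasurableSet.univ.prod measurableSet_Ioo)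
      fun p hp => ?_
    have : p.1 ∉ tsupport ζ := fun h => hp.2 ⟨h, Ioo_subset_Icc_self hp.1.2⟩
    simp [H, image_eq_zero_of_notMem_tsupport this]
  have hD := hw.density t ht
  rw [IntegrableOn, Measure.volume_eq_prod, ← Measure.prod_restrict, Measure.restrict_univ]
    at hHi hD
  have hftc : ∀ x, ∫ τ in Ioo 0 t, H (x, τ) = ζ x * w x t ^ 2 - ζ x * w x 0 ^ 2 := fun x => by
    have hc : ContinuousOn (fun τ => H (x, τ)) (Icc 0 t) :=
      hH.comp (by fun_prop) fun τ hτ => ⟨mem_univ _, hτ.1⟩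
    have hcw : ContinuousOn (fun τ => w x τ) (Icc 0 t) :=
      hw.smooth.continuousOn.comp (f := fun τ : ℝ => (x, τ)) (by fun_prop)
        fun τ hτ => ⟨mem_univ _, hτ.1⟩
    rw [← integral_Ioc_eq_integral_Ioo, ← intervalIntegral.integral_of_le ht.le]
    refine intervalIntegral.integral_eq_sub_of_hasDerivAt_of_le (f := fun τ => ζ x * w x τ ^ 2)
      ht.le (continuousOn_const.mul (hcw.pow 2)) (fun τ hτ => ?_)
      (hc.mono (by rw [uIcc_of_le ht.le])).intervalIntegrable
    have h := ((hw.equation x τ hτ.1).fun_pow 2).const_mul (ζ x)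
    refine h.congr_deriv ?_
    simp only [H]
    ring
  have hζi : ∀ s, 0 ≤ s → Integrable fun x => ζ x * w x s ^ 2 := fun s hs =>
    (hζ.continuous.mul ((hw.slice hs).continuous.pow 2)).integrable_of_hasCompactSupport
      hζc.mul_right
  have e1 : (∫ x, ζ x * w x t ^ 2) - ∫ x, ζ x * w x 0 ^ 2 = ∫ τ in Ioo 0 t, ∫ x, H (x, τ) := by
    rw [← integral_sub (hζi t ht.le) (hζi 0 le_rfl)]
    rw [← integral_integral_swap (f := fun x τ => H (x, τ)) hHi]
    exact integral_congr_ae (.of_forall fun x => (hftc x).symm)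
  have e2 : ∫ p in univ ×ˢ Ioo 0 t, sobolevDensity (fun y => w y (Prod.snd p)) (Prod.fst p) =
      ∫ τ in Ioo 0 t, ∫ x, sobolevDensity (fun y => w y τ) x := by
    rw [Measure.volume_eq_prod, ← Measure.prod_restrict, Measure.restrict_univ]
    exact integral_prod_symm _ hD
  have e3 : ∫ τ in Ioo 0 t, ∫ x, H (x, τ) ≤
      ∫ τ in Ioo 0 t, ε * (2 * (2 * n + 1)) * ∫ x, sobolevDensity (fun y => w y τ) x := by
    refine integral_mono_ae hHi.integral_prod_right (hD.integral_prod_right.const_mul _) ?_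
    filter_upwards [hD.prod_left_ae, ae_restrict_mem measurableSet_Ioo] with τ h1 hτ
    have h2 := neg_integral_mul_bilaplacian_le hζ hζc hζ0 hζ1 hζ2 (hw.slice hτ.1.le) h1 hε
    simp only [H]
    rw [integral_const_mul]
    linarith
  rw [integral_const_mul] at e3
  rw [e2]
  linarith

/-- The cut-off radius `k + 1` tends to infinity. The error is `C/(k + 1)` times a fixed space-time
integral, and the cut-off energies converge by dominated convergence. -/
theorem EnergyClass.energy_le {w : EuclideanSpace ℝ (Fin n) → ℝ → ℝ} (hw : EnergyClass w) {t : ℝ}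
    (ht : 0 < t) : ∫ x, w x t ^ 2 ≤ ∫ x, w x 0 ^ 2 := by
  obtain ⟨C, hC, h⟩ := exists_cutoff_slowly_varying n
  have hk : ∀ k : ℕ, (1 : ℝ) ≤ k + 1 := fun k => by linarith [(Nat.cast_nonneg k : (0 : ℝ) ≤ k)]
  choose ζ hζ hζc hζ0 hζ1 hζone hd1 hd2 using fun k : ℕ => h (k + 1) (hk k)
  set A := 2 * (2 * n + 1) * ∫ p in univ ×ˢ Ioo 0 t,
        sobolevDensity (fun y => w y (Prod.snd p)) (Prod.fst p) with hA
  have hle : ∀ k, ∫ x, ζ k x * w x t ^ 2 ≤ (∫ x, w x 0 ^ 2) + C / (k + 1) * A := fun k => by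
    refine (hw.cutoff_energy_le (hζ k) (hζc k) (hζ0 k) (hd1 k) (hd2 k) (by positivity) ht).trans ?_
    gcongr ?_ + _
    refine integral_mono_of_nonneg (.of_forall fun x => mul_nonneg (hζ0 k x) (sq_nonneg _))
      (hw.slice_sq 0 le_rfl) (.of_forall fun x => ?_)
    exact mul_le_of_le_one_left (sq_nonneg _) (hζ1 k x)
  have l1 : Filter.Tendsto (fun k => ∫ x, ζ k x * w x t ^ 2) Filter.atTop
      (nhds (∫ x, w x t ^ 2)) := by
    refine tendsto_integral_of_dominated_convergence (fun x => w x t ^ 2)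
      (fun k => ((hζ k).continuous.mul
        ((hw.slice ht.le).continuous.pow 2)).aestronglyMeasurable) (hw.slice_sq t ht.le)
      (fun k => .of_forall fun x => ?_) (.of_forall fun x => ?_)
    · rw [Real.norm_of_nonneg (mul_nonneg (hζ0 k x) (sq_nonneg _))]
      exact mul_le_of_le_one_left (sq_nonneg _) (hζ1 k x)
    · refine tendsto_const_nhds.congr' ?_
      filter_upwards [Filter.eventually_ge_atTop ⌈‖x‖⌉₊] with k hk
      rw [hζone k x, one_mul]
      have : ‖x‖ ≤ k := (Nat.le_ceil _).trans (by exact_mod_cast hk)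
      linarith
  have l2 : Filter.Tendsto (fun k : ℕ => (∫ x, w x 0 ^ 2) + C / (k + 1) * A) Filter.atTop
      (nhds ((∫ x, w x 0 ^ 2) + 0 * A)) :=
    ((tendsto_const_div_atTop_nhds_zero_nat C).comp (Filter.tendsto_add_atTop_nat 1)
      |>.congr (fun k => by simp)).mul_const A |>.const_add _
  simpa using le_of_tendsto_of_tendsto' l1 l2 hle

/-! ### Energy decay for `∂ᵢu` and `Δu`. -/

theorem norm_sq_pd_le {g : EuclideanSpace ℝ (Fin n) → ℝ} (hg : ContDiff ℝ ∞ g) (i : Fin n)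
    (x : EuclideanSpace ℝ (Fin n)) : pd i g x ^ 2 ≤ ‖iteratedFDeriv ℝ 1 g x‖ ^ 2 := by
  rw [← sq_abs]
  refine pow_le_pow_left₀ (abs_nonneg _) ?_ 2
  simpa using norm_iteratedFDeriv_pd_le hg i 0 x

theorem laplacian_sq_le (g : EuclideanSpace ℝ (Fin n) → ℝ) (x : EuclideanSpace ℝ (Fin n)) :
    Laplacian.laplacian g x ^ 2 ≤ n ^ 2 * ‖iteratedFDeriv ℝ 2 g x‖ ^ 2 := by
  rw [← sq_abs, ← mul_pow]
  exact pow_le_pow_left₀ (abs_nonneg _) (abs_laplacian_le g x) 2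

theorem sobolevDensity_nonneg (g : EuclideanSpace ℝ (Fin n) → ℝ)
    (x : EuclideanSpace ℝ (Fin n)) : 0 ≤ sobolevDensity g x := by
  have : 0 ≤ ∑ i, pd i g x ^ 2 := Finset.sum_nonneg fun i _ => sq_nonneg _
  unfold sobolevDensity
  positivity

theorem sobolevDensity_pd_le {g : EuclideanSpace ℝ (Fin n) → ℝ} (hg : ContDiff ℝ ∞ g)
    (i : Fin n) (x : EuclideanSpace ℝ (Fin n)) :
    sobolevDensity (pd i g) x ≤ ‖iteratedFDeriv ℝ 1 g x‖ ^ 2 +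
      n * ‖iteratedFDeriv ℝ 2 g x‖ ^ 2 + n ^ 2 * ‖iteratedFDeriv ℝ 3 g x‖ ^ 2 := by
  unfold sobolevDensity
  have hm : ∀ l, ‖iteratedFDeriv ℝ l (pd i g) x‖ ^ 2 ≤ ‖iteratedFDeriv ℝ (l + 1) g x‖ ^ 2 :=
    fun l => pow_le_pow_left₀ (norm_nonneg _) (norm_iteratedFDeriv_pd_le hg i l x) 2
  gcongr ?_ + ?_ + ?_
  · exact norm_sq_pd_le hg i x
  · refine (Finset.sum_le_card_nsmul _ _ (‖iteratedFDeriv ℝ 2 g x‖ ^ 2) fun j _ =>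
      (norm_sq_pd_le (contDiff_pd hg i) j x).trans (hm 1)).trans (by simp)
  · exact (laplacian_sq_le _ x).trans (mul_le_mul_of_nonneg_left (hm 2) (by positivity))

theorem abs_laplacian_laplacian_le {g : EuclideanSpace ℝ (Fin n) → ℝ} (hg : ContDiff ℝ ∞ g)
    (x : EuclideanSpace ℝ (Fin n)) :
    |Laplacian.laplacian (Laplacian.laplacian g) x| ≤ n * (n * ‖iteratedFDeriv ℝ 4 g x‖) := by
  rw [laplacian_eq_sum_pd hg,
    laplacian_sum _ fun i _ => contDiff_pd (contDiff_pd hg i) i]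
  refine (Finset.abs_sum_le_sum_abs _ _).trans ?_
  refine (Finset.sum_le_card_nsmul _ _ (n * ‖iteratedFDeriv ℝ 4 g x‖) fun j _ => ?_).trans (by simp)
  refine (abs_laplacian_le _ x).trans (mul_le_mul_of_nonneg_left ?_ (Nat.cast_nonneg n))
  exact (norm_iteratedFDeriv_pd_le (contDiff_pd hg j) j 2 x).trans
    (norm_iteratedFDeriv_pd_le hg j 3 x)

theorem sobolevDensity_laplacian_le {g : EuclideanSpace ℝ (Fin n) → ℝ} (hg : ContDiff ℝ ∞ g)
    (x : EuclideanSpace ℝ (Fin n)) :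
    sobolevDensity (Laplacian.laplacian g) x ≤ n ^ 2 * ‖iteratedFDeriv ℝ 2 g x‖ ^ 2 +
      n * (n ^ 2 * ‖iteratedFDeriv ℝ 3 g x‖ ^ 2) + n ^ 4 * ‖iteratedFDeriv ℝ 4 g x‖ ^ 2 := by
  unfold sobolevDensity
  gcongr ?_ + ?_ + ?_
  · exact laplacian_sq_le g x
  · refine (Finset.sum_le_card_nsmul _ _ (n ^ 2 * ‖iteratedFDeriv ℝ 3 g x‖ ^ 2)
      fun j _ => ?_).trans (by simp)
    rw [pd_laplacian hg]
    refine (laplacian_sq_le _ x).trans (mul_le_mul_of_nonneg_left ?_ (by positivity))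
    exact pow_le_pow_left₀ (norm_nonneg _) (norm_iteratedFDeriv_pd_le hg j 2 x) 2
  · rw [← sq_abs]
    refine (pow_le_pow_left₀ (abs_nonneg _) (abs_laplacian_laplacian_le hg x) 2).trans (le_of_eq ?_)
    ring

/-- `D` is an integrable majorant built from the assumed `L²` bounds: derivatives of orders 1 to 3
serve for `∂ᵢu`, orders 2 to 4 for `Δu`. -/
theorem BiheatSol.energyClass {w : EuclideanSpace ℝ (Fin n) → ℝ → ℝ} (hw : BiheatSol w)
    (h0 : ∀ t, 0 ≤ t → Integrable fun x => w x t ^ 2)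
    {D : EuclideanSpace ℝ (Fin n) × ℝ → ℝ}
    (hD : ∀ T : ℝ, 0 < T → IntegrableOn D (univ ×ˢ Ioo 0 T))
    (hle : ∀ x t, 0 ≤ t → sobolevDensity (fun y => w y t) x ≤ D (x, t)) : EnergyClass w where
  toBiheatSol := hw
  slice_sq := h0
  density T hT := by
    have hU := uniqueDiffOn_Ici (0 : ℝ)
    have hc : ContinuousOn (fun p : EuclideanSpace ℝ (Fin n) × ℝ =>
        sobolevDensity (fun y => w y p.2) p.1) (univ ×ˢ Ici 0) :=
      ((hw.smooth.continuousOn.pow 2).add (continuousOn_finsetSum _ fun i _ =>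
        (contDiffOn_pd hU hw.smooth i).continuousOn.pow 2)).add
        ((contDiffOn_laplacian hU hw.smooth).continuousOn.pow 2)
    have hms : MeasurableSet ((univ : Set (EuclideanSpace ℝ (Fin n))) ×ˢ Ioo 0 T) :=
      MeasurableSet.univ.prod measurableSet_Ioo
    refine (hD T hT).mono' ((hc.mono (prod_mono le_rfl fun s hs => hs.1.le)).aestronglyMeasurable
      hms) ?_
    filter_upwards [ae_restrict_mem hms] with p hp
    rw [Real.norm_of_nonneg (sobolevDensity_nonneg _ _)]
    exact hle p.1 p.2 hp.2.1.le

theorem energyClass_pd {u : EuclideanSpace ℝ (Fin n) → ℝ → ℝ} (hu : BiheatSol u)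
    (h : HasL2Bounds u) (i : Fin n) : EnergyClass fun x t => pd i (fun y => u y t) x := by
  refine (hu.pd i).energyClass (D := fun p => ‖iteratedFDeriv ℝ 1 (fun y => u y p.2) p.1‖ ^ 2 +
    n * ‖iteratedFDeriv ℝ 2 (fun y => u y p.2) p.1‖ ^ 2 +
    n ^ 2 * ‖iteratedFDeriv ℝ 3 (fun y => u y p.2) p.1‖ ^ 2) (fun t ht => integrable_sq_of_zero
    (integrable_sq_pd (hu.slice ht) (h.slice 1 (by simp) t ht) i)) (fun T hT => ?_)
    fun x t ht => sobolevDensity_pd_le (hu.slice ht) i x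
  exact ((h.local_in_time 1 (by simp) T hT).add
    ((h.local_in_time 2 (by simp) T hT).const_mul _)).add
    ((h.local_in_time 3 (by simp) T hT).const_mul _)

theorem integrable_sq_laplacian {f : EuclideanSpace ℝ (Fin n) → ℝ} (hf : ContDiff ℝ ∞ f)
    (h : Integrable fun x => ‖iteratedFDeriv ℝ 2 f x‖ ^ 2) :
    Integrable fun x => Laplacian.laplacian f x ^ 2 := by
  refine (h.const_mul (n ^ 2 : ℝ)).mono'
    ((contDiff_laplacian hf).continuous.pow 2).aestronglyMeasurable (.of_forall fun x => ?_)
  rw [Real.norm_of_nonneg (sq_nonneg _)]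
  exact laplacian_sq_le f x

theorem energyClass_laplacian {u : EuclideanSpace ℝ (Fin n) → ℝ → ℝ} (hu : BiheatSol u)
    (h : HasL2Bounds u) : EnergyClass fun x t => Laplacian.laplacian (fun y => u y t) x := by
  refine hu.laplacian.energyClass (D := fun p =>
    n ^ 2 * ‖iteratedFDeriv ℝ 2 (fun y => u y p.2) p.1‖ ^ 2 +
    n * (n ^ 2 * ‖iteratedFDeriv ℝ 3 (fun y => u y p.2) p.1‖ ^ 2) +
    n ^ 4 * ‖iteratedFDeriv ℝ 4 (fun y => u y p.2) p.1‖ ^ 2) (fun t ht => integrable_sq_laplacian (hu.slice ht)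
    (h.slice 2 (by simp) t ht)) (fun T hT => ?_)
    fun x t ht => sobolevDensity_laplacian_le (hu.slice ht) x
  exact (((h.local_in_time 2 (by simp) T hT).const_mul _).add
    (((h.local_in_time 3 (by simp) T hT).const_mul _).const_mul _)).add
    ((h.local_in_time 4 (by simp) T hT).const_mul _)

theorem laplacianEnergy_le {u : EuclideanSpace ℝ (Fin n) → ℝ → ℝ} (hu : BiheatSol u)
    (h : HasL2Bounds u) {t : ℝ} (ht : 0 < t) :
    laplacianEnergy (fun x => u x t) ≤ laplacianEnergy fun x => u x 0 :=
  (energyClass_laplacian hu h).energy_le ht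

theorem gradientEnergy_eq_sum {f : EuclideanSpace ℝ (Fin n) → ℝ} (hf : ContDiff ℝ ∞ f)
    (h : Integrable fun x => ‖iteratedFDeriv ℝ 1 f x‖ ^ 2) :
    gradientEnergy f = ∑ i, ∫ x, pd i f x ^ 2 := by
  unfold gradientEnergy
  simp only [norm_gradient_sq]
  exact integral_finsetSum _ fun i _ => integrable_sq_of_zero (integrable_sq_pd hf h i)

theorem gradientEnergy_le {u : EuclideanSpace ℝ (Fin n) → ℝ → ℝ} (hu : BiheatSol u)
    (h : HasL2Bounds u) {t : ℝ} (ht : 0 < t) :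
    gradientEnergy (fun x => u x t) ≤ gradientEnergy fun x => u x 0 := by
  rw [gradientEnergy_eq_sum (hu.slice ht.le) (h.slice 1 (by simp) t ht.le),
    gradientEnergy_eq_sum (hu.slice le_rfl) (h.slice 1 (by simp) 0 le_rfl)]
  exact Finset.sum_le_sum fun i _ => (energyClass_pd hu h i).energy_le ht

/-- `∫_{B_r} |∇u(t)|² ≤ 2 r (∫ |∇u₀|² + ∫ |Δu₀|²)`. -/
theorem setIntegral_ball_gradient_sq_le (hn : 2 ≤ n) {u : EuclideanSpace ℝ (Fin n) → ℝ → ℝ}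
    (hu : BiheatSol u) (h : HasL2Bounds u) {t : ℝ} (ht : 0 < t) (x₀ : EuclideanSpace ℝ (Fin n))
    {r : ℝ} (hr : 0 < r) :
    ∫ x in Metric.closedBall x₀ r, ‖gradient (fun y => u y t) x‖ ^ 2 ≤
      2 * r * (gradientEnergy (fun x => u x 0) + laplacianEnergy fun x => u x 0) := by
  have hs := hu.slice ht.le
  have h1 := h.slice 1 (by simp) t ht.le
  have h2 := h.slice 2 (by simp) t ht.le
  have i1 := fun i => integrable_sq_of_zero (integrable_sq_pd hs h1 i)
  have i2 := fun i j => integrable_sq_of_zero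
    (integrable_sq_pd (contDiff_pd hs j) (integrable_sq_pd hs h2 j) i)
  simp only [norm_gradient_sq]
  rw [integral_finsetSum _ fun i _ => (i1 i).integrableOn]
  -- The local estimate for each `∂ⱼu` produces the full Hessian; its energy is `∫|Δu|²`, which does
  -- not increase in time.
  refine (Finset.sum_le_sum fun j _ => setIntegral_ball_sq_le hn (contDiff_pd hs j) (i1 j)
    (fun i => i2 i j) x₀ hr).trans ?_
  rw [← Finset.mul_sum, Finset.sum_add_distrib, ← gradientEnergy_eq_sum hs h1,
    sum_integral_pd_pd_sq hs fun l hl => h.slice l (Finset.Icc_subset_Icc_right (by simp) hl) t ht.le]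
  gcongr
  · exact gradientEnergy_le hu h ht
  · exact laplacianEnergy_le hu h ht

/-! ### The radial profile near the origin -/

/-- From `Γ(x + 1) = x Γ(x)` with `x ≥ 1`, the last because `n ≥ 2`. It removes the Gamma factor
from the series, leaving an exponential series. -/
theorem gamma_half_le (hn : 2 ≤ n) (m : ℕ) :
    Real.Gamma (n / 2) ≤ Real.Gamma (((n : ℝ) - 2) / 2 + m + 1) := by
  have hn' : (2 : ℝ) ≤ n := by exact_mod_cast hn
  induction m with
  | zero => exact le_of_eq (congrArg _ (by push_cast; ring))
  | succ k ih =>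
    have h1 : 1 ≤ ((n : ℝ) - 2) / 2 + k + 1 := by
      have : (0 : ℝ) ≤ k := Nat.cast_nonneg k
      linarith
    rw [show ((n : ℝ) - 2) / 2 + (k + 1 : ℕ) + 1 = (((n : ℝ) - 2) / 2 + k + 1) + 1 by push_cast; ring,
      Real.Gamma_add_one (by linarith)]
    exact ih.trans (le_mul_of_one_le_left (Real.Gamma_pos_of_pos (by linarith)).le h1)

theorem gamma_half_pos (hn : 2 ≤ n) : 0 < Real.Gamma (n / 2) :=
  Real.Gamma_pos_of_pos (by positivity)

/-- The integrand of the `m`-th coefficient of the profile, up to sign. -/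
def profileTerm (n m : ℕ) (s : ℝ) : ℝ :=
  Real.exp (-s ^ 4) * s ^ ((n : ℝ) - 1) *
    ((s ^ 2 / 4) ^ m / (m.factorial * Real.Gamma (((n : ℝ) - 2) / 2 + m + 1)))

theorem profileTerm_pos (hn : 2 ≤ n) (m : ℕ) {s : ℝ} (hs : 0 < s) : 0 < profileTerm n m s := by
  have := (gamma_half_pos hn).trans_le (gamma_half_le hn m)
  unfold profileTerm
  positivity

/-- The partial sums are dominated by `exp(s²/4)`, which `exp(-s⁴)` absorbs; the Gaussian majorant
does not depend on `N`. -/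
theorem sum_profileTerm_le (hn : 2 ≤ n) (N : ℕ) {s : ℝ} (hs : 0 < s) :
    ∑ m ∈ Finset.range N, profileTerm n m s ≤
      Real.exp 1 / Real.Gamma (n / 2) * (s ^ ((n : ℝ) - 1) * Real.exp (-1 * s ^ 2)) := by
  have hG := gamma_half_pos hn
  have h1 : ∀ m ∈ Finset.range N, profileTerm n m s ≤
      Real.exp (-s ^ 4) * s ^ ((n : ℝ) - 1) / Real.Gamma (n / 2) *
        ((s ^ 2 / 4) ^ m / m.factorial) := fun m _ => by
    unfold profileTerm
    rw [div_mul_eq_mul_div, mul_div_assoc, div_div]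
    gcongr
    exact gamma_half_le hn m
  refine (Finset.sum_le_sum h1).trans ?_
  rw [← Finset.mul_sum]
  have h2 := Real.sum_le_exp_of_nonneg (x := s ^ 2 / 4) (by positivity) N
  have h3 : Real.exp (-s ^ 4) * Real.exp (s ^ 2 / 4) ≤ Real.exp 1 * Real.exp (-1 * s ^ 2) := by
    rw [← Real.exp_add, ← Real.exp_add]
    -- `s⁴ - (5/4) s² + 1 = (s² - 5/8)² + 39/64`.
    exact Real.exp_le_exp.2 (by nlinarith [sq_nonneg (s ^ 2 - 5 / 8)])
  calc Real.exp (-s ^ 4) * s ^ ((n : ℝ) - 1) / Real.Gamma (n / 2) *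
        ∑ m ∈ Finset.range N, (s ^ 2 / 4) ^ m / m.factorial
      ≤ Real.exp (-s ^ 4) * s ^ ((n : ℝ) - 1) / Real.Gamma (n / 2) * Real.exp (s ^ 2 / 4) := by
        gcongr
    _ = s ^ ((n : ℝ) - 1) / Real.Gamma (n / 2) * (Real.exp (-s ^ 4) * Real.exp (s ^ 2 / 4)) := by
        ring
    _ ≤ s ^ ((n : ℝ) - 1) / Real.Gamma (n / 2) * (Real.exp 1 * Real.exp (-1 * s ^ 2)) := by
        gcongr
    _ = _ := by ring

theorem integrableOn_profile_majorant (hn : 2 ≤ n) : IntegrableOn (fun s : ℝ =>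
    Real.exp 1 / Real.Gamma (n / 2) * (s ^ ((n : ℝ) - 1) * Real.exp (-1 * s ^ 2))) (Ioi 0) := by
  have hn' : (2 : ℝ) ≤ n := by exact_mod_cast hn
  exact (integrableOn_rpow_mul_exp_neg_mul_sq one_pos (by linarith)).const_mul _

theorem integrableOn_profileTerm (hn : 2 ≤ n) (m : ℕ) : IntegrableOn (profileTerm n m) (Ioi 0) := by
  refine (integrableOn_profile_majorant hn).mono' ?_ ?_
  · refine ContinuousOn.aestronglyMeasurable (fun s hs => ?_) measurableSet_Ioi
    have hs : 0 < s := hs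
    refine ContinuousAt.continuousWithinAt ?_
    unfold profileTerm
    have := Real.continuousAt_rpow_const s ((n : ℝ) - 1) (Or.inl hs.ne')
    fun_prop
  · filter_upwards [ae_restrict_mem measurableSet_Ioi] with s hs
    rw [Real.norm_of_nonneg (profileTerm_pos hn m hs).le]
    exact (Finset.single_le_sum (f := fun m => profileTerm n m s)
      (fun k _ => (profileTerm_pos hn k hs).le) (Finset.self_mem_range_succ m)).trans
      (sum_profileTerm_le hn (m + 1) hs)

/-- Non-negative terms with uniformly bounded partial sums. This is absolute convergence of the
profile series at `|η| = 1`, and it justifies exchanging sum and integral for `|η| ≤ 1`. -/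
theorem summable_integral_profileTerm (hn : 2 ≤ n) :
    Summable fun m => ∫ s in Ioi 0, profileTerm n m s := by
  refine summable_of_sum_range_le (c := ∫ s in Ioi 0,
    Real.exp 1 / Real.Gamma (n / 2) * (s ^ ((n : ℝ) - 1) * Real.exp (-1 * s ^ 2)))
    (fun m => setIntegral_nonneg measurableSet_Ioi fun s hs => (profileTerm_pos hn m hs).le)
    fun N => ?_
  rw [← integral_finsetSum _ fun m _ => integrableOn_profileTerm hn m]
  exact setIntegral_mono_on (integrable_finsetSum _ fun m _ => integrableOn_profileTerm hn m)
    (integrableOn_profile_majorant hn) measurableSet_Ioi fun s hs => sum_profileTerm_le hn N hs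

/-- The coefficients of the profile as a power series in `η²`. -/
def profileCoeff (n m : ℕ) : ℝ :=
  2 ^ (1 - (n : ℝ) / 2) * ((-1) ^ m * ∫ s in Ioi 0, profileTerm n m s)

theorem integral_profileTerm_pos (hn : 2 ≤ n) (m : ℕ) : 0 < ∫ s in Ioi 0, profileTerm n m s := by
  rw [setIntegral_pos_iff_support_of_nonneg_ae _ (integrableOn_profileTerm hn m)]
  · have : Function.support (profileTerm n m) ∩ Ioi 0 = Ioi 0 :=
      inter_eq_right.2 fun s hs => (profileTerm_pos hn m hs).ne'
    rw [this]
    simp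
  · filter_upwards [ae_restrict_mem measurableSet_Ioi] with s hs
    exact (profileTerm_pos hn m hs).le

theorem profileCoeff_zero_pos (hn : 2 ≤ n) : 0 < profileCoeff n 0 := by
  have := integral_profileTerm_pos hn 0
  unfold profileCoeff
  positivity

theorem profileCoeff_one_neg (hn : 2 ≤ n) : profileCoeff n 1 < 0 := by
  have := integral_profileTerm_pos hn 1
  have h : (0 : ℝ) < 2 ^ (1 - (n : ℝ) / 2) := by positivity
  unfold profileCoeff
  rw [pow_one, neg_one_mul, mul_neg, neg_lt_zero]
  positivity

theorem summable_profileCoeff (hn : 2 ≤ n) : Summable fun m => ‖profileCoeff n m‖ := by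
  refine ((summable_integral_profileTerm hn).mul_left (2 ^ (1 - (n : ℝ) / 2))).congr fun m => ?_
  rw [profileCoeff, norm_mul, norm_mul, norm_pow, norm_neg, norm_one, one_pow, one_mul,
    Real.norm_of_nonneg (integral_profileTerm_pos hn m).le, Real.norm_of_nonneg (by positivity)]

theorem profile_eq_tsum (hn : 2 ≤ n) {η : ℝ} (hη : |η| ≤ 1) :
    profile n η = ∑' m, profileCoeff n m * (η ^ 2) ^ m := by
  have hη2 : η ^ 2 ≤ 1 := by rw [← sq_abs]; exact pow_le_one₀ (abs_nonneg _) hη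
  have e : ∀ s, Real.exp (-s ^ 4) * s ^ ((n : ℝ) - 1) * besselP (((n : ℝ) - 2) / 2) (η * s) =
      ∑' m : ℕ, (-1) ^ m * (η ^ 2) ^ m * profileTerm n m s := fun s => by
    rw [besselP, ← tsum_mul_left]
    refine tsum_congr fun m => ?_
    rw [profileTerm, pow_mul, show (η * s / 2) ^ 2 = η ^ 2 * (s ^ 2 / 4) by ring, mul_pow]
    ring
  have hi : ∀ m, Integrable (fun s => (-1) ^ m * (η ^ 2) ^ m * profileTerm n m s)
      (volume.restrict (Ioi 0)) := fun m => (integrableOn_profileTerm hn m).const_mul _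
  have hs : Summable fun m => ∫ s in Ioi 0, ‖(-1) ^ m * (η ^ 2) ^ m * profileTerm n m s‖ := by
    refine (summable_integral_profileTerm hn).of_nonneg_of_le
      (fun m => integral_nonneg fun s => norm_nonneg _) fun m => ?_
    refine setIntegral_mono_on (hi m).norm (integrableOn_profileTerm hn m) measurableSet_Ioi
      fun s hs => ?_
    rw [norm_mul, norm_mul, norm_pow, norm_neg, norm_one, one_pow, one_mul,
      Real.norm_of_nonneg (by positivity), Real.norm_of_nonneg (profileTerm_pos hn m hs).le]
    exact mul_le_of_le_one_left (profileTerm_pos hn m hs).le (pow_le_one₀ (sq_nonneg _) hη2)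
  unfold profile
  simp only [e]
  rw [← integral_tsum_of_summable_integral_norm hi hs, ← tsum_mul_left]
  refine tsum_congr fun m => ?_
  rw [integral_const_mul, profileCoeff]
  ring

/-- Using `η²` as the variable makes the kernel smooth at the origin of `ℝⁿ`, where `|y|` is not.
Absolute summability of the coefficients gives radius of convergence at least one, and `F 0`, `F' 0`
are the first two coefficients. -/
theorem exists_analytic_profile (hn : 2 ≤ n) : ∃ F : ℝ → ℝ, AnalyticAt ℝ F 0 ∧ 0 < F 0 ∧
    deriv F 0 < 0 ∧ ∀ η, |η| ≤ 1 → profile n η = F (η ^ 2) := by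
  let p := FormalMultilinearSeries.ofScalars ℝ (profileCoeff n)
  have hr : (1 : ENNReal) ≤ p.radius := by
    refine p.le_radius_of_summable_norm (r := 1) ?_
    simpa [p, FormalMultilinearSeries.ofScalars_norm] using summable_profileCoeff hn
  have hp : HasFPowerSeriesAt p.sum p 0 :=
    (p.hasFPowerSeriesOnBall (one_pos.trans_le hr)).hasFPowerSeriesAt
  have hsum : ∀ x, p.sum x = ∑' m, profileCoeff n m * x ^ m := fun x => by
    have := FormalMultilinearSeries.ofScalars_sum_eq (E := ℝ) (profileCoeff n) x
    simp only [smul_eq_mul] at this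
    exact this
  refine ⟨p.sum, hp.analyticAt, ?_, ?_, fun η hη => ?_⟩
  · rw [hsum, tsum_eq_single 0 fun m hm => by simp [hm]]
    simpa using profileCoeff_zero_pos hn
  · rw [hp.deriv]
    simpa [p, FormalMultilinearSeries.ofScalars_apply_eq] using profileCoeff_one_neg hn
  · rw [hsum, profile_eq_tsum hn hη]

/-- The kernel profile as a function on `ℝⁿ`. -/
def spaceProfile (n : ℕ) (y : EuclideanSpace ℝ (Fin n)) : ℝ := profile n ‖y‖

/-- The Hessian of `F(|y|²)` at the origin is `2 F'(0)` times the identity, so the Laplacian there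
is `2n F'(0)`. -/
theorem spaceProfile_local (hn : 2 ≤ n) : ContDiffAt ℝ 2 (spaceProfile n) 0 ∧
    0 < spaceProfile n 0 ∧ Laplacian.laplacian (spaceProfile n) 0 < 0 := by
  obtain ⟨F, hF, hF0, hF1, hFe⟩ := exists_analytic_profile hn
  have hev : spaceProfile n =ᶠ[nhds 0] fun y => F (‖y‖ ^ 2) := by
    filter_upwards [Metric.closedBall_mem_nhds (0 : EuclideanSpace ℝ (Fin n)) one_pos] with y hy
    exact hFe _ (by simpa using hy)
  have hq : ContDiff ℝ 2 fun y : EuclideanSpace ℝ (Fin n) => ‖y‖ ^ 2 := contDiff_norm_sq ℝ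
  have hq0 : ‖(0 : EuclideanSpace ℝ (Fin n))‖ ^ 2 = 0 := by simp
  have hc : ContDiffAt ℝ 2 (fun y : EuclideanSpace ℝ (Fin n) => F (‖y‖ ^ 2)) 0 :=
    ContDiffAt.comp (g := F) 0 (by rw [hq0]; exact hF.contDiffAt) hq.contDiffAt
  refine ⟨hc.congr_of_eventuallyEq hev, ?_, ?_⟩
  · rw [hev.eq_of_nhds, hq0]; exact hF0
  · rw [(InnerProductSpace.laplacian_congr_nhds hev).eq_of_nhds,
      InnerProductSpace.laplacian_eq_iteratedFDeriv_orthonormalBasis _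
        (EuclideanSpace.basisFun (Fin n) ℝ)]
    have hd : ∀ᶠ y : EuclideanSpace ℝ (Fin n) in nhds 0,
        fderiv ℝ (fun y : EuclideanSpace ℝ (Fin n) => F (‖y‖ ^ 2)) y =
          deriv F (‖y‖ ^ 2) • (2 • innerSL ℝ y) := by
      have h1 : ∀ᶠ z in nhds (‖(0 : EuclideanSpace ℝ (Fin n))‖ ^ 2), DifferentiableAt ℝ F z := by
        rw [hq0]
        exact hF.eventually_analyticAt.mono fun z hz => hz.differentiableAt
      filter_upwards [hq.continuous.continuousAt.eventually h1] with y hy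
      have h2 : HasFDerivAt (fun y : EuclideanSpace ℝ (Fin n) => ‖y‖ ^ 2) (2 • innerSL ℝ y) y := by
        have h : HasFDerivAt (fun y => y) (ContinuousLinearMap.id ℝ (EuclideanSpace ℝ (Fin n))) y :=
          hasFDerivAt_id y
        simpa only [ContinuousLinearMap.comp_id] using h.norm_sq
      exact (hy.hasDerivAt.comp_hasFDerivAt y h2).fderiv
    have hd2 : HasFDerivAt (fun y : EuclideanSpace ℝ (Fin n) =>
        deriv F (‖y‖ ^ 2) • (2 • innerSL ℝ y)) (deriv F 0 • (2 • innerSL ℝ)) 0 := by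
      have h3 : DifferentiableAt ℝ (fun y : EuclideanSpace ℝ (Fin n) => deriv F (‖y‖ ^ 2)) 0 :=
        DifferentiableAt.comp (g := deriv F) 0
          (by rw [hq0]; exact hF.deriv.differentiableAt) (hq.differentiable (by simp) 0)
      have h4 : HasFDerivAt (fun y : EuclideanSpace ℝ (Fin n) => 2 • innerSL ℝ y)
          (2 • innerSL ℝ : EuclideanSpace ℝ (Fin n) →L[ℝ] EuclideanSpace ℝ (Fin n) →L[ℝ] ℝ) 0 :=
        (2 • innerSL ℝ : EuclideanSpace ℝ (Fin n) →L[ℝ] _).hasFDerivAt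
      have h5 := h3.hasFDerivAt.smul h4
      refine h5.congr_fderiv ?_
      ext v w
      simp
    have hd3 : fderiv ℝ (fderiv ℝ fun y : EuclideanSpace ℝ (Fin n) => F (‖y‖ ^ 2)) 0 =
        deriv F 0 • (2 • innerSL ℝ) := by
      rw [Filter.EventuallyEq.fderiv_eq hd, hd2.fderiv]
    simp only [iteratedFDeriv_two_apply, hd3]
    have hn' : (0 : ℝ) < n := by exact_mod_cast (by omega : 0 < n)
    have he : ∀ i, (deriv F 0 • (2 • innerSL ℝ) :
        EuclideanSpace ℝ (Fin n) →L[ℝ] EuclideanSpace ℝ (Fin n) →L[ℝ] ℝ)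
        (EuclideanSpace.basisFun (Fin n) ℝ i) (EuclideanSpace.basisFun (Fin n) ℝ i) =
        deriv F 0 * 2 := fun i => by
      change deriv F 0 * (2 • inner ℝ (EuclideanSpace.basisFun (Fin n) ℝ i)
        (EuclideanSpace.basisFun (Fin n) ℝ i)) = _
      rw [real_inner_self_eq_norm_sq, OrthonormalBasis.norm_eq_one]
      simp
    simp only [Matrix.cons_val_zero, Matrix.cons_val_one, he, Finset.sum_const, Finset.card_univ,
      Fintype.card_fin, nsmul_eq_mul]
    nlinarith

theorem continuousAt_laplacian {f : EuclideanSpace ℝ (Fin n) → ℝ} {x : EuclideanSpace ℝ (Fin n)}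
    (hf : ContDiffAt ℝ 2 f x) : ContinuousAt (Laplacian.laplacian f) x := by
  rw [InnerProductSpace.laplacian_eq_iteratedFDeriv_orthonormalBasis f
    (EuclideanSpace.basisFun (Fin n) ℝ)]
  have h := hf.continuousAt_iteratedFDeriv (k := 2) le_rfl
  refine tendsto_finsetSum _ fun i _ => ?_
  exact ((ContinuousMultilinearMap.apply ℝ (fun _ : Fin 2 => EuclideanSpace ℝ (Fin n)) ℝ
    _).continuous.continuousAt.tendsto).comp h

/-- Near the origin the kernel profile is positive and superharmonic, with bounds. -/
theorem exists_spaceProfile_bounds (hn : 2 ≤ n) : ∃ δ > 0, ∃ K > 0,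
    ∀ y : EuclideanSpace ℝ (Fin n), ‖y‖ ≤ δ →
      ContinuousAt (spaceProfile n) y ∧ ContinuousAt (Laplacian.laplacian (spaceProfile n)) y ∧
      0 ≤ spaceProfile n y ∧ spaceProfile n y ≤ K ∧
      -K ≤ Laplacian.laplacian (spaceProfile n) y ∧
      Laplacian.laplacian (spaceProfile n) y ≤ 0 := by
  obtain ⟨hc, h0, h1⟩ := spaceProfile_local hn
  have hcL := continuousAt_laplacian hc
  have hev : ∀ᶠ y in nhds (0 : EuclideanSpace ℝ (Fin n)), ContDiffAt ℝ 2 (spaceProfile n) y :=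
    hc.eventually (by simp)
  have e1 := hc.continuousAt.eventually (lt_mem_nhds h0)
  have e2 := hc.continuousAt.eventually (gt_mem_nhds (lt_add_one (spaceProfile n 0)))
  have e3 := hcL.eventually (gt_mem_nhds h1)
  have e4 := hcL.eventually (lt_mem_nhds (sub_one_lt (Laplacian.laplacian (spaceProfile n) 0)))
  obtain ⟨δ, hδ, H⟩ := Metric.eventually_nhds_iff.1
    (hev.and (e1.and (e2.and (e3.and e4))))
  -- Halving `δ` passes from an open to a closed ball. `K` adds the upper bounds of the profile and
  -- of minus its Laplacian, both positive, so that one constant serves for both.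
  refine ⟨δ / 2, half_pos hδ,
    (spaceProfile n 0 + 1) + (1 - Laplacian.laplacian (spaceProfile n) 0), by linarith,
    fun y hy => ?_⟩
  obtain ⟨a, b, c, d, e⟩ := H (y := y) (by rw [dist_zero_right]; linarith)
  exact ⟨a.continuousAt, continuousAt_laplacian a, b.le, by linarith, by linarith, d.le⟩

/-! ### Parabolic scaling -/

/-- Values in a general `F` allow a second application, to the derivative itself. No
differentiability is assumed, so the scaling identities below hold for arbitrary functions. -/
theorem fderiv_affine {F : Type*} [NormedAddCommGroup F] [NormedSpace ℝ F]
    (g : EuclideanSpace ℝ (Fin n) → F) (c l : ℝ) (a b x : EuclideanSpace ℝ (Fin n)) :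
    fderiv ℝ (fun y => c • g (a + l • (y - b))) x = (c * l) • fderiv ℝ g (a + l • (x - b)) := by
  have h1 : fderiv ℝ (fun y => c • g (a + l • (y - b))) =
      c • fderiv ℝ (fun y => g (a + l • (y - b))) := fderiv_const_smul_field c
  have h2 : fderiv ℝ (fun y => g (a + l • (y - b))) x =
      fderiv ℝ (fun z => g (a + l • z)) (x - b) := by
    have := fderiv_comp_add_right (𝕜 := ℝ) (f := fun z => g (a + l • z)) (x := x) (-b)
    simpa only [← sub_eq_add_neg] using this
  have h3 : fderiv ℝ (fun z => g (a + l • z)) (x - b) =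
      l • fderiv ℝ (fun z => g (a + z)) (l • (x - b)) :=
    fderiv_comp_smul (f := fun z => g (a + z)) l
  rw [h1, Pi.smul_apply, h2, h3, fderiv_comp_add_left, smul_smul]

theorem laplacian_affine (g : EuclideanSpace ℝ (Fin n) → ℝ) (c l : ℝ)
    (a b x : EuclideanSpace ℝ (Fin n)) :
    Laplacian.laplacian (fun y => c * g (a + l • (y - b))) x =
      c * l ^ 2 * Laplacian.laplacian g (a + l • (x - b)) := by
  simp only [InnerProductSpace.laplacian_eq_iteratedFDeriv_orthonormalBasis _
        (EuclideanSpace.basisFun (Fin n) ℝ), iteratedFDeriv_two_apply, Finset.mul_sum]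
  refine Finset.sum_congr rfl fun i _ => ?_
  have h1 : fderiv ℝ (fun y => c * g (a + l • (y - b))) =
      fun y => (c * l) • fderiv ℝ g (a + l • (y - b)) := funext fun y => fderiv_affine g c l a b y
  rw [h1, show fderiv ℝ (fun y => (c * l) • fderiv ℝ g (a + l • (y - b))) x = _ from
    fderiv_affine (fderiv ℝ g) (c * l) l a b x]
  simp only [FunLike.coe_smul, Pi.smul_apply, smul_eq_mul]
  rw [sq, ← mul_assoc c l l]

theorem norm_gradient_affine (g : EuclideanSpace ℝ (Fin n) → ℝ) (l : ℝ)
    (a b x : EuclideanSpace ℝ (Fin n)) :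
    ‖gradient (fun y => g (a + l • (y - b))) x‖ = |l| * ‖gradient g (a + l • (x - b))‖ := by
  have := fderiv_affine g 1 l a b x
  simp only [one_smul, one_mul] at this
  rw [norm_gradient, norm_gradient, this, norm_smul, Real.norm_eq_abs]

/-- The summand `0` gives the right-hand side the shape required by `laplacian_affine`. -/
theorem backwardKernel_eq (x₀ : EuclideanSpace ℝ (Fin n)) {t₀ t : ℝ} (ht : t < t₀)
    (y : EuclideanSpace ℝ (Fin n)) :
    backwardKernel x₀ t₀ y t = normConst n / (t₀ - t) ^ ((n : ℝ) / 4) *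
      spaceProfile n (0 + ((t₀ - t) ^ ((1 : ℝ) / 4))⁻¹ • (y - x₀)) := by
  have hτ : 0 < t₀ - t := sub_pos.2 ht
  rw [backwardKernel, kernel, spaceProfile, zero_add, norm_smul,
    Real.norm_of_nonneg (by positivity), ← div_eq_inv_mul]
  ring

theorem laplacian_backwardKernel (x₀ : EuclideanSpace ℝ (Fin n)) {t₀ t : ℝ} (ht : t < t₀)
    (y : EuclideanSpace ℝ (Fin n)) :
    Laplacian.laplacian (fun y => backwardKernel x₀ t₀ y t) y =
      normConst n / (t₀ - t) ^ ((n : ℝ) / 4) * (((t₀ - t) ^ ((1 : ℝ) / 4))⁻¹) ^ 2 *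
      Laplacian.laplacian (spaceProfile n) (0 + ((t₀ - t) ^ ((1 : ℝ) / 4))⁻¹ • (y - x₀)) := by
  rw [← laplacian_affine]
  simp only [backwardKernel_eq x₀ ht]

theorem backwardKernel_scaling (x₀ : EuclideanSpace ℝ (Fin n)) {t₀ t l : ℝ} (ht : t < t₀)
    (hl : 0 < l) (y : EuclideanSpace ℝ (Fin n)) :
    backwardKernel x₀ t₀ y t =
      l ^ n * backwardKernel x₀ t₀ (x₀ + l • (y - x₀)) (t₀ + l ^ 4 * (t - t₀)) := by
  have hτ : 0 < t₀ - t := sub_pos.2 ht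
  have e : t₀ - (t₀ + l ^ 4 * (t - t₀)) = l ^ 4 * (t₀ - t) := by ring
  have hp : ∀ a : ℝ, (l ^ 4 * (t₀ - t)) ^ (a / 4) = l ^ a * (t₀ - t) ^ (a / 4) := fun a => by
    rw [Real.mul_rpow (by positivity) hτ.le, ← Real.rpow_natCast l 4, ← Real.rpow_mul hl.le]
    congr 2
    push_cast; ring
  rw [backwardKernel, backwardKernel, kernel, kernel, e, hp, hp, Real.rpow_natCast, Real.rpow_one,
    add_sub_cancel_left, norm_smul, Real.norm_of_nonneg hl.le, mul_div_mul_left _ _ hl.ne']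
  field_simp

theorem laplacian_backwardKernel_scaling (x₀ : EuclideanSpace ℝ (Fin n)) {t₀ t l : ℝ} (ht : t < t₀)
    (hl : 0 < l) (y : EuclideanSpace ℝ (Fin n)) :
    Laplacian.laplacian (fun y => backwardKernel x₀ t₀ y t) y = l ^ n * l ^ 2 *
      Laplacian.laplacian (fun y => backwardKernel x₀ t₀ y (t₀ + l ^ 4 * (t - t₀)))
        (x₀ + l • (y - x₀)) := by
  rw [← laplacian_affine (fun y => backwardKernel x₀ t₀ y (t₀ + l ^ 4 * (t - t₀)))]
  simp only [← backwardKernel_scaling x₀ ht hl]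

/-- `l^(n + 4)` is the Jacobian of the parabolic dilation. Here it splits as `l⁴` from `|Δu|²` and
`lⁿ` from `B`; in the gradient density, as `l²` from `|∇u|²` and `l^(n + 2)` from `ΔB`. -/
theorem laplacianDensity_rescale (x₀ : EuclideanSpace ℝ (Fin n)) {t₀ t l : ℝ} (ht : t < t₀)
    (hl : 0 < l) (u : EuclideanSpace ℝ (Fin n) → ℝ → ℝ) (φ : EuclideanSpace ℝ (Fin n) → ℝ)
    (y : EuclideanSpace ℝ (Fin n)) :
    laplacianDensity x₀ t₀ (rescale x₀ t₀ l u) (rescaleSpace x₀ l φ) (y, t) =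
      l ^ (n + 4) *
        laplacianDensity x₀ t₀ u φ (x₀ + l • (y - x₀), t₀ + l ^ 4 * (t - t₀)) := by
  have h := laplacian_affine (fun y => u y (t₀ + l ^ 4 * (t - t₀))) 1 l x₀ x₀ y
  simp only [one_mul] at h
  simp only [laplacianDensity, rescale, rescaleSpace]
  rw [h, backwardKernel_scaling x₀ ht hl]
  ring

theorem gradientDensity_rescale (x₀ : EuclideanSpace ℝ (Fin n)) {t₀ t l : ℝ} (ht : t < t₀)
    (hl : 0 < l) (u : EuclideanSpace ℝ (Fin n) → ℝ → ℝ) (φ : EuclideanSpace ℝ (Fin n) → ℝ)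
    (y : EuclideanSpace ℝ (Fin n)) :
    gradientDensity x₀ t₀ (rescale x₀ t₀ l u) (rescaleSpace x₀ l φ) (y, t) =
      l ^ (n + 4) *
        gradientDensity x₀ t₀ u φ (x₀ + l • (y - x₀), t₀ + l ^ 4 * (t - t₀)) := by
  have h := norm_gradient_affine (fun y => u y (t₀ + l ^ 4 * (t - t₀))) l x₀ x₀ y
  simp only [gradientDensity, rescale, rescaleSpace]
  rw [h, laplacian_backwardKernel_scaling x₀ ht hl, abs_of_pos hl]
  ring

theorem measurableSet_layer (t₀ R : ℝ) : MeasurableSet (layer n t₀ R) :=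
  MeasurableSet.univ.prod measurableSet_Ioo

theorem setIntegral_layer_scaling (x₀ : EuclideanSpace ℝ (Fin n)) (t₀ : ℝ) {l : ℝ} (hl : 0 < l)
    (r : ℝ) (f : EuclideanSpace ℝ (Fin n) × ℝ → ℝ) :
    ∫ p in layer n t₀ (l * r), f p =
      ∫ p in layer n t₀ r, l ^ (n + 4) * f (x₀ + l • (p.1 - x₀), t₀ + l ^ 4 * (p.2 - t₀)) := by
  let Φ : EuclideanSpace ℝ (Fin n) × ℝ → EuclideanSpace ℝ (Fin n) × ℝ :=
    fun p => (x₀ + l • (p.1 - x₀), t₀ + l ^ 4 * (p.2 - t₀))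
  let L : EuclideanSpace ℝ (Fin n) × ℝ →L[ℝ] EuclideanSpace ℝ (Fin n) × ℝ :=
    (l • ContinuousLinearMap.id ℝ (EuclideanSpace ℝ (Fin n))).prodMap
      (l ^ 4 • ContinuousLinearMap.id ℝ ℝ)
  have hl4 : 0 < l ^ 4 := by positivity
  have hΦ : ∀ p, HasFDerivAt Φ L p := fun p => by
    have h1 : HasFDerivAt (fun p : EuclideanSpace ℝ (Fin n) × ℝ => x₀ + l • (p.1 - x₀))
        (l • ContinuousLinearMap.fst ℝ _ _) p :=
      ((hasFDerivAt_fst.sub_const x₀).const_smul l).const_add x₀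
    have h2 : HasFDerivAt (fun p : EuclideanSpace ℝ (Fin n) × ℝ => t₀ + l ^ 4 * (p.2 - t₀))
        (l ^ 4 • ContinuousLinearMap.snd ℝ _ _) p :=
      ((hasFDerivAt_snd.sub_const t₀).const_mul (l ^ 4)).const_add t₀
    exact h1.prodMk h2
  have hdet : L.det = l ^ (n + 4) := by
    have : (L : EuclideanSpace ℝ (Fin n) × ℝ →ₗ[ℝ] EuclideanSpace ℝ (Fin n) × ℝ) =
        (l • LinearMap.id).prodMap (l ^ 4 • LinearMap.id) := rfl
    rw [ContinuousLinearMap.det, this, LinearMap.det_prodMap, LinearMap.det_smul,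
      LinearMap.det_smul]
    simp [pow_add]
  have hinj : InjOn Φ (layer n t₀ r) := fun p _ q _ h => by
    have h1 := congrArg Prod.fst h
    have h2 := congrArg Prod.snd h
    simp only [Φ, add_right_inj] at h1 h2
    refine Prod.ext ?_ ?_
    · exact sub_left_injective (smul_right_injective _ hl.ne' h1)
    · exact sub_left_injective (mul_left_cancel₀ hl4.ne' h2)
  have himg : layer n t₀ (l * r) = Φ '' layer n t₀ r := by
    ext p
    constructor
    · rintro ⟨-, hp1, hp2⟩
      refine ⟨(x₀ + l⁻¹ • (p.1 - x₀), t₀ + (l ^ 4)⁻¹ * (p.2 - t₀)), ⟨mem_univ _, ?_, ?_⟩, ?_⟩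
      · rw [sub_lt_iff_lt_add', ← sub_lt_iff_lt_add] at hp1
        simp only
        have : -(16 * r ^ 4) < (l ^ 4)⁻¹ * (p.2 - t₀) := by
          rw [← div_eq_inv_mul, lt_div_iff₀ hl4]
          nlinarith
        linarith
      · simp only
        have : (l ^ 4)⁻¹ * (p.2 - t₀) < -r ^ 4 := by
          rw [← div_eq_inv_mul, div_lt_iff₀ hl4]
          nlinarith
        linarith
      · refine Prod.ext ?_ ?_
        · simp [Φ, smul_smul, mul_inv_cancel₀ hl.ne']
        · simp only [Φ]
          rw [add_sub_cancel_left, ← mul_assoc, mul_inv_cancel₀ hl4.ne']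
          ring
    · rintro ⟨q, ⟨-, hq1, hq2⟩, rfl⟩
      refine ⟨mem_univ _, ?_, ?_⟩
      · simp only [Φ]; nlinarith [mul_pos hl4 (sub_pos.2 hq1)]
      · simp only [Φ]; nlinarith [mul_pos hl4 (sub_pos.2 hq2)]
  have : Measure.IsAddHaarMeasure (volume : Measure (EuclideanSpace ℝ (Fin n) × ℝ)) :=
    inferInstanceAs (((volume : Measure (EuclideanSpace ℝ (Fin n))).prod
      (volume : Measure ℝ)).IsAddHaarMeasure)
  rw [himg, integral_image_eq_integral_abs_det_fderiv_smul volume (measurableSet_layer t₀ r)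
    (fun p _ => (hΦ p).hasFDerivWithinAt) hinj]
  simp only [hdet, abs_of_pos (pow_pos hl (n + 4)), smul_eq_mul, Φ]

/-- A pure change of variables, without integrability, regularity or support conditions; it
therefore also applies to the weight `1`. -/
theorem Psi_scaling (x₀ : EuclideanSpace ℝ (Fin n)) (t₀ : ℝ) {l r : ℝ} (hl : 0 < l) (hr : r ≠ 0)
    (u : EuclideanSpace ℝ (Fin n) → ℝ → ℝ) (φ : EuclideanSpace ℝ (Fin n) → ℝ) :
    Psi x₀ t₀ u (l * r) φ = Psi x₀ t₀ (rescale x₀ t₀ l u) r (rescaleSpace x₀ l φ) := by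
  have hlt : ∀ p ∈ layer n t₀ r, p.2 < t₀ := fun p hp => by
    have := hp.2.2
    have : 0 < r ^ 4 := by positivity
    linarith
  rw [Psi, Psi, setIntegral_layer_scaling x₀ t₀ hl, setIntegral_layer_scaling x₀ t₀ hl]
  congr 2
  · exact setIntegral_congr_fun (measurableSet_layer t₀ r) fun p hp =>
      (laplacianDensity_rescale x₀ (hlt p hp) hl u φ p.1).symm
  · exact setIntegral_congr_fun (measurableSet_layer t₀ r) fun p hp =>
      (gradientDensity_rescale x₀ (hlt p hp) hl u φ p.1).symm

/-! ### Shrinking solitons -/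

/-- Along the dilation orbit `γ` one has `m · d/dm v(γ(m)) = Sol v (γ(m)) = 0`, so `v` is constant
on the orbit, and `m = 1` gives the original point. -/
theorem IsShrinkingSoliton.rescale_eq {x₀ : EuclideanSpace ℝ (Fin n)} {t₀ : ℝ}
    {v : EuclideanSpace ℝ (Fin n) → ℝ → ℝ} (hv : IsShrinkingSoliton x₀ t₀ v) {l t : ℝ}
    (hl : 0 < l) (ht : 0 < t) (htt : t < t₀) (hlt : 0 < t₀ + l ^ 4 * (t - t₀))
    (x : EuclideanSpace ℝ (Fin n)) : rescale x₀ t₀ l v x t = v x t := by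
  let γ : ℝ → EuclideanSpace ℝ (Fin n) × ℝ := fun m => (x₀ + m • (x - x₀), t₀ + m ^ 4 * (t - t₀))
  let V : EuclideanSpace ℝ (Fin n) × ℝ → ℝ := fun p => v p.1 p.2
  let S : Set ℝ := {m | 0 < m ∧ 0 < t₀ + m ^ 4 * (t - t₀)}
  have hcont : Continuous fun m : ℝ => t₀ + m ^ 4 * (t - t₀) := by fun_prop
  have hSo : IsOpen S := (isOpen_lt continuous_const continuous_id).inter
    (isOpen_lt continuous_const hcont)
  -- The time component decreases in `m` because `t < t₀`, so its positivity at the larger end point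
  -- suffices.
  have hSc : S.OrdConnected := ⟨fun a ha b hb m hm => by
    have hm0 : 0 < m := ha.1.trans_le hm.1
    refine ⟨hm0, ?_⟩
    have h1 : m ^ 4 ≤ b ^ 4 := pow_le_pow_left₀ hm0.le hm.2 4
    have h2 := hb.2
    nlinarith⟩
  have hder : ∀ m ∈ S, HasDerivAt (V ∘ γ) 0 m := fun m hm => by
    have hs : (γ m).2 ∈ Ioo 0 t₀ := ⟨hm.2, by
      have := mul_pos (pow_pos hm.1 4) (sub_pos.2 htt)
      simp only [γ]; linarith⟩
    have hnhds : (univ : Set (EuclideanSpace ℝ (Fin n))) ×ˢ Ico 0 t₀ ∈ nhds (γ m) :=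
      prod_mem_nhds Filter.univ_mem (Ico_mem_nhds hs.1 hs.2)
    have hV : HasFDerivAt V (fderiv ℝ V (γ m)) (γ m) :=
      ((hv.solution.smooth.contDiffAt hnhds).differentiableAt (by simp)).hasFDerivAt
    have hγ : HasDerivAt γ (x - x₀, 4 * m ^ 3 * (t - t₀)) m := by
      have h1 : HasDerivAt (fun m : ℝ => x₀ + m • (x - x₀)) (x - x₀) m := by
        simpa using ((hasDerivAt_id m).smul_const (x - x₀)).const_add x₀
      have h2 : HasDerivAt (fun m : ℝ => t₀ + m ^ 4 * (t - t₀)) (4 * m ^ 3 * (t - t₀)) m := by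
        simpa using ((hasDerivAt_pow 4 m).mul_const (t - t₀)).const_add t₀
      exact h1.prodMk h2
    have hg : ∀ w, inner ℝ (gradient (fun y => v y (γ m).2) (γ m).1) w =
        fderiv ℝ V (γ m) (w, 0) := fun w => by
      have h1 : HasFDerivAt (fun y : EuclideanSpace ℝ (Fin n) => (y, (γ m).2))
          ((ContinuousLinearMap.id ℝ _).prod 0) (γ m).1 :=
        (hasFDerivAt_id _).prodMk (hasFDerivAt_const _ _)
      have h2 : fderiv ℝ (fun y => v y (γ m).2) (γ m).1 = _ :=
        (HasFDerivAt.comp (g := V) (γ m).1 hV h1).fderiv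
      rw [inner_gradient_left, h2]
      simp
    have hd : deriv (fun s => v (γ m).1 s) (γ m).2 = fderiv ℝ V (γ m) (0, 1) := by
      have h1 : HasDerivAt (fun s : ℝ => ((γ m).1, s)) ((0 : EuclideanSpace ℝ (Fin n)), (1 : ℝ))
          (γ m).2 := (hasDerivAt_const _ _).prodMk (hasDerivAt_id _)
      exact (HasFDerivAt.comp_hasDerivAt (l := V) (γ m).2 hV h1).deriv
    have hsol := hv.sol_eq_zero (γ m).1 (γ m).2 hs
    rw [sol, hg, hd] at hsol
    refine (hV.comp_hasDerivAt m hγ).congr_deriv ?_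
    have e1 : ((γ m).1 - x₀, (0 : ℝ)) = m • (x - x₀, (0 : ℝ)) := by simp [γ]
    have e2 : (x - x₀, 4 * m ^ 3 * (t - t₀)) =
        (x - x₀, (0 : ℝ)) + (4 * m ^ 3 * (t - t₀)) • ((0 : EuclideanSpace ℝ (Fin n)), (1 : ℝ)) := by
      simp
    have e3 : (γ m).2 - t₀ = m ^ 4 * (t - t₀) := by simp [γ]
    rw [e1, e3, map_smul, smul_eq_mul] at hsol
    rw [e2, map_add, map_smul, smul_eq_mul]
    refine mul_left_cancel₀ hm.1.ne' ?_
    linear_combination hsol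
  have hconst := hSo.is_const_of_deriv_eq_zero hSc.isPreconnected
    (fun m hm => (hder m hm).differentiableAt.differentiableWithinAt)
    (fun m hm => (hder m hm).deriv) (x := l) (y := 1) ⟨hl, hlt⟩ ⟨one_pos, by simpa using ht⟩
  simpa [V, γ, rescale] using hconst

theorem sixteen_mul_pow_lt {t₀ R : ℝ} (ht₀ : 0 < t₀) (hR : 0 < R) (h : R < maxRadius t₀) :
    16 * R ^ 4 < t₀ := by
  have h1 : 2 * R < t₀ ^ ((1 : ℝ) / 4) := by
    have := h.trans_le (min_le_left _ _)
    linarith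
  have h2 : (2 * R) ^ 4 < (t₀ ^ ((1 : ℝ) / 4)) ^ 4 := pow_lt_pow_left₀ h1 (by positivity) (by simp)
  rw [← Real.rpow_natCast (t₀ ^ ((1 : ℝ) / 4)), ← Real.rpow_mul ht₀.le] at h2
  norm_num at h2
  linarith

/-- Dilation by `r/R` carries `T_R` onto `T_r` and leaves `v` unchanged, so `Ψ` takes the same value
at all radii near `R`. -/
theorem IsShrinkingSoliton.hasDerivAt_Psi {x₀ : EuclideanSpace ℝ (Fin n)} {t₀ : ℝ} (ht₀ : 0 < t₀)
    {v : EuclideanSpace ℝ (Fin n) → ℝ → ℝ} (hv : IsShrinkingSoliton x₀ t₀ v) {R : ℝ}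
    (hR : 0 < R) (hRm : R < maxRadius t₀) :
    HasDerivAt (fun r => Psi x₀ t₀ v r fun _ => 1) 0 R := by
  refine (hasDerivAt_const R (Psi x₀ t₀ v R fun _ => 1)).congr_of_eventuallyEq ?_
  filter_upwards [Ioo_mem_nhds hR hRm] with r hr
  have hl : 0 < r / R := div_pos hr.1 hR
  have hRt := sixteen_mul_pow_lt ht₀ hR hRm
  have hrt := sixteen_mul_pow_lt ht₀ hr.1 hr.2
  have key : ∀ p ∈ layer n t₀ R, (fun y => rescale x₀ t₀ (r / R) v y p.2) = fun y => v y p.2 :=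
    fun p hp => by
      obtain ⟨-, h1, h2⟩ := hp
      have hR4 : 0 < R ^ 4 := by positivity
      funext y
      refine hv.rescale_eq hl (by linarith) (by linarith) ?_ y
      -- Rescaled times stay positive because `16 r⁴ < t₀`, which comes from the strict bound on
      -- `r`.
      have h3 : (r / R) ^ 4 * (t₀ - p.2) ≤ (r / R) ^ 4 * (16 * R ^ 4) := by
        gcongr
        linarith
      have h4 : (r / R) ^ 4 * (16 * R ^ 4) = 16 * r ^ 4 := by
        field_simp
      nlinarith
  have e : r = r / R * R := by field_simp
  calc Psi x₀ t₀ v r (fun _ => 1) = Psi x₀ t₀ v (r / R * R) (fun _ => 1) := by rw [← e]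
    _ = Psi x₀ t₀ (rescale x₀ t₀ (r / R) v) R (fun _ => 1) :=
      Psi_scaling x₀ t₀ hl hR.ne' v _
    _ = Psi x₀ t₀ v R (fun _ => 1) := by
      unfold Psi
      congr 2
      · exact setIntegral_congr_fun (measurableSet_layer t₀ R) fun p hp => by
          simp only [laplacianDensity, key p hp]
      · exact setIntegral_congr_fun (measurableSet_layer t₀ R) fun p hp => by
          simp only [gradientDensity, key p hp]

/-! ### The weighted densities -/

/-- On the ball of radius `δ` the kernel profile is regular, non-negative and superharmonic, with
bounds by `K`. -/
def ProfileBounds (n : ℕ) (δ K : ℝ) : Prop :=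
  ∀ y : EuclideanSpace ℝ (Fin n), ‖y‖ ≤ δ →
    ContinuousAt (spaceProfile n) y ∧ ContinuousAt (Laplacian.laplacian (spaceProfile n)) y ∧
    0 ≤ spaceProfile n y ∧ spaceProfile n y ≤ K ∧
    -K ≤ Laplacian.laplacian (spaceProfile n) y ∧
    Laplacian.laplacian (spaceProfile n) y ≤ 0

/-- A continuous weight with values in `[0,1]` that vanishes outside the ball of radius `r`. -/
structure IsWeight (φ : EuclideanSpace ℝ (Fin n) → ℝ) (r : ℝ) : Prop where
  continuous : Continuous φ
  nonneg : ∀ x, 0 ≤ φ x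
  le_one : ∀ x, φ x ≤ 1
  eq_zero : ∀ x, r < ‖x‖ → φ x = 0

theorem normConst_pos (n : ℕ) : 0 < normConst n := by
  unfold normConst
  positivity

theorem quarter_rpow_pow {τ : ℝ} (hτ : 0 < τ) (k : ℕ) :
    τ ^ ((k : ℝ) / 4) = (τ ^ ((1 : ℝ) / 4)) ^ k := by
  rw [← Real.rpow_natCast, ← Real.rpow_mul hτ.le]
  congr 1
  ring

theorem le_quarter_rpow {τ R : ℝ} (hR : 0 ≤ R) (h : R ^ 4 ≤ τ) : R ≤ τ ^ ((1 : ℝ) / 4) := by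
  calc R = (R ^ 4) ^ ((1 : ℝ) / 4) := by
        rw [← Real.rpow_natCast, ← Real.rpow_mul hR]
        norm_num
    _ ≤ _ := Real.rpow_le_rpow (by positivity) h (by norm_num)

theorem quarter_rpow_le {τ R : ℝ} (hR : 0 ≤ R) (hτ : 0 ≤ τ) (h : τ ≤ R ^ 4) :
    τ ^ ((1 : ℝ) / 4) ≤ R := by
  calc _ ≤ (R ^ 4) ^ ((1 : ℝ) / 4) := Real.rpow_le_rpow hτ h (by norm_num)
    _ = R := by
        rw [← Real.rpow_natCast, ← Real.rpow_mul hR]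
        norm_num

/-- The reason for `r ≤ δ R₀`: on the support of the weight the kernel is evaluated only where the
signs and bounds of the profile are known. -/
theorem norm_rescaled_le {δ R₀ r c : ℝ} (hR₀ : 0 < R₀) (hr : r ≤ δ * R₀)
    (hc : R₀ ≤ c) (hδ : 0 ≤ δ) {z : EuclideanSpace ℝ (Fin n)} (hz : ‖z‖ ≤ r) :
    ‖(0 : EuclideanSpace ℝ (Fin n)) + c⁻¹ • z‖ ≤ δ := by
  have hc0 : 0 < c := hR₀.trans_le hc
  rw [zero_add, norm_smul, Real.norm_of_nonneg (inv_nonneg.2 hc0.le), ← div_eq_inv_mul,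
    div_le_iff₀ hc0]
  exact (hz.trans hr).trans (mul_le_mul_of_nonneg_left hc hδ)

theorem laplacianDensity_bounds {δ K R₀ r : ℝ} (hδ : 0 ≤ δ) (H : ProfileBounds n δ K)
    (hK : 0 ≤ K) (hR₀ : 0 < R₀) (hr : r ≤ δ * R₀) {φ : EuclideanSpace ℝ (Fin n) → ℝ}
    (hφ : IsWeight φ r) (x₀ : EuclideanSpace ℝ (Fin n)) {t₀ t : ℝ} (ht : t ≤ t₀ - R₀ ^ 4)
    (u : EuclideanSpace ℝ (Fin n) → ℝ → ℝ) (x : EuclideanSpace ℝ (Fin n)) :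
    0 ≤ laplacianDensity x₀ t₀ u (fun x => φ (x - x₀)) (x, t) ∧
    laplacianDensity x₀ t₀ u (fun x => φ (x - x₀)) (x, t) ≤
      normConst n * K / ((t₀ - t) ^ ((1 : ℝ) / 4)) ^ n *
        Laplacian.laplacian (fun y => u y t) x ^ 2 := by
  have hR4 : 0 < R₀ ^ 4 := by positivity
  have hτ : 0 < t₀ - t := by linarith
  have hc : R₀ ≤ (t₀ - t) ^ ((1 : ℝ) / 4) := le_quarter_rpow hR₀.le (by linarith)
  have ha := normConst_pos n
  set c := (t₀ - t) ^ ((1 : ℝ) / 4) with hcdef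
  have hc0 : 0 < c := hR₀.trans_le hc
  by_cases hx : r < ‖x - x₀‖
  · simp only [laplacianDensity, hφ.eq_zero _ hx, mul_zero, le_refl, true_and]
    positivity
  · obtain ⟨-, -, h1, h2, -, -⟩ := H _ (norm_rescaled_le hR₀ hr hc hδ (not_lt.1 hx))
    simp only [laplacianDensity]
    rw [backwardKernel_eq x₀ (by linarith), quarter_rpow_pow hτ, ← hcdef]
    set S := spaceProfile n (0 + c⁻¹ • (x - x₀))
    set D := Laplacian.laplacian (fun y => u y t) x
    have p0 := hφ.nonneg (x - x₀)
    have p1 := hφ.le_one (x - x₀)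
    refine ⟨by positivity, ?_⟩
    calc D ^ 2 * (normConst n / c ^ n * S) * φ (x - x₀)
        ≤ D ^ 2 * (normConst n / c ^ n * K) * 1 := by gcongr
      _ = _ := by ring

/-- The indicator of the small ball is retained here: smallness of `r` must later compensate the two
additional negative powers of `c`. -/
theorem gradientDensity_bounds {δ K R₀ r : ℝ} (hδ : 0 ≤ δ) (H : ProfileBounds n δ K)
    (hK : 0 ≤ K) (hR₀ : 0 < R₀) (hr : r ≤ δ * R₀) {φ : EuclideanSpace ℝ (Fin n) → ℝ}
    (hφ : IsWeight φ r) (x₀ : EuclideanSpace ℝ (Fin n)) {t₀ t : ℝ} (ht : t ≤ t₀ - R₀ ^ 4)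
    (u : EuclideanSpace ℝ (Fin n) → ℝ → ℝ) (x : EuclideanSpace ℝ (Fin n)) :
    0 ≤ -gradientDensity x₀ t₀ u (fun x => φ (x - x₀)) (x, t) ∧
    -gradientDensity x₀ t₀ u (fun x => φ (x - x₀)) (x, t) ≤
      normConst n * K / ((t₀ - t) ^ ((1 : ℝ) / 4)) ^ (n + 2) *
        (Metric.closedBall x₀ r).indicator (fun x => ‖gradient (fun y => u y t) x‖ ^ 2) x := by
  have hR4 : 0 < R₀ ^ 4 := by positivity
  have hτ : 0 < t₀ - t := by linarith
  have hc : R₀ ≤ (t₀ - t) ^ ((1 : ℝ) / 4) := le_quarter_rpow hR₀.le (by linarith)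
  have ha := normConst_pos n
  set c := (t₀ - t) ^ ((1 : ℝ) / 4) with hcdef
  have hc0 : 0 < c := hR₀.trans_le hc
  by_cases hx : r < ‖x - x₀‖
  · have hx' : x ∉ Metric.closedBall x₀ r := by simpa [dist_eq_norm] using hx
    simp [gradientDensity, hφ.eq_zero _ hx, hx']
  · have hx' : x ∈ Metric.closedBall x₀ r := by simpa [dist_eq_norm] using hx
    obtain ⟨-, -, -, -, h1, h2⟩ := H _ (norm_rescaled_le hR₀ hr hc hδ (not_lt.1 hx))
    rw [indicator_of_mem hx']
    simp only [gradientDensity]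
    rw [laplacian_backwardKernel x₀ (by linarith), quarter_rpow_pow hτ, ← hcdef]
    set S := Laplacian.laplacian (spaceProfile n) (0 + c⁻¹ • (x - x₀))
    set D := ‖gradient (fun y => u y t) x‖
    have p0 := hφ.nonneg (x - x₀)
    have p1 := hφ.le_one (x - x₀)
    have hS : 0 ≤ -S := by linarith
    have e : -(D ^ 2 * (normConst n / c ^ n * c⁻¹ ^ 2 * S) * φ (x - x₀)) =
        D ^ 2 * (normConst n / c ^ n * c⁻¹ ^ 2 * -S) * φ (x - x₀) := by ring
    rw [e]
    refine ⟨by positivity, ?_⟩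
    calc D ^ 2 * (normConst n / c ^ n * c⁻¹ ^ 2 * -S) * φ (x - x₀)
        ≤ D ^ 2 * (normConst n / c ^ n * c⁻¹ ^ 2 * K) * 1 := by
          gcongr
          linarith
      _ = _ := by
          rw [pow_add]
          field_simp

theorem continuousOn_pd_slice {u : EuclideanSpace ℝ (Fin n) → ℝ → ℝ} (hu : BiheatSol u) :
    ContinuousOn (fun p : EuclideanSpace ℝ (Fin n) × ℝ => ‖gradient (fun y => u y p.2) p.1‖ ^ 2)
      (univ ×ˢ Ici 0) := by
  simp only [norm_gradient_sq]
  exact continuousOn_finsetSum _ fun i _ =>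
    (contDiffOn_pd (uniqueDiffOn_Ici 0) hu.smooth i).continuousOn.pow 2

/-! ### Convergence of the integrals and signs of the two terms. -/

/-- The closed horizontal strip `ℝⁿ × [a,b]`. -/
def strip (n : ℕ) (a b : ℝ) : Set (EuclideanSpace ℝ (Fin n) × ℝ) := univ ×ˢ Icc a b

/-- The weight confines both densities to the compact set `Q`. There `t₀ - t` is bounded away from
zero and all factors are continuous. -/
theorem integrableOn_strip {δ K R₀ r : ℝ} (hδ : 0 ≤ δ) (H : ProfileBounds n δ K)
    (hR₀ : 0 < R₀) (hr : r ≤ δ * R₀) {φ : EuclideanSpace ℝ (Fin n) → ℝ}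
    (hφ : IsWeight φ r) (x₀ : EuclideanSpace ℝ (Fin n)) {t₀ a b : ℝ} (ha : 0 ≤ a)
    (hb : b ≤ t₀ - R₀ ^ 4) {u : EuclideanSpace ℝ (Fin n) → ℝ → ℝ} (hu : BiheatSol u) :
    IntegrableOn (laplacianDensity x₀ t₀ u fun x => φ (x - x₀)) (strip n a b) ∧
    IntegrableOn (gradientDensity x₀ t₀ u fun x => φ (x - x₀)) (strip n a b) := by
  set Q : Set (EuclideanSpace ℝ (Fin n) × ℝ) := Metric.closedBall x₀ r ×ˢ Icc a b with hQ
  have hR4 : 0 < R₀ ^ 4 := by positivity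
  have hQc : IsCompact Q := (isCompact_closedBall x₀ r).prod isCompact_Icc
  have hsub : Q ⊆ univ ×ˢ Ici 0 := prod_mono (subset_univ _) fun t ht => ha.trans ht.1
  have hτ : ∀ p ∈ Q, 0 < t₀ - p.2 := fun p hp => by linarith [hp.2.2]
  have hcont : ∀ k : ℝ, ContinuousOn (fun p : EuclideanSpace ℝ (Fin n) × ℝ => (t₀ - p.2) ^ k) Q :=
    fun k => ContinuousOn.rpow_const (by fun_prop) fun p hp => Or.inl (hτ p hp).ne'
  have hinv : ∀ k : ℝ, ContinuousOn
      (fun p : EuclideanSpace ℝ (Fin n) × ℝ => ((t₀ - p.2) ^ k)⁻¹) Q :=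
    fun k => (hcont k).inv₀ fun p hp => (Real.rpow_pos_of_pos (hτ p hp) _).ne'
  have harg : ContinuousOn (fun p : EuclideanSpace ℝ (Fin n) × ℝ =>
      0 + ((t₀ - p.2) ^ ((1 : ℝ) / 4))⁻¹ • (p.1 - x₀)) Q :=
    continuousOn_const.add ((hinv _).smul (by fun_prop))
  have hball : ∀ p ∈ Q, ‖0 + ((t₀ - p.2) ^ ((1 : ℝ) / 4))⁻¹ • (p.1 - x₀)‖ ≤ δ := fun p hp =>
    norm_rescaled_le hR₀ hr (le_quarter_rpow hR₀.le (by linarith [hp.2.2])) hδ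
      (by simpa [dist_eq_norm] using hp.1)
  have hφc : ContinuousOn (fun p : EuclideanSpace ℝ (Fin n) × ℝ => φ (p.1 - x₀)) Q :=
    (hφ.continuous.comp (by fun_prop)).continuousOn
  have hpre : ContinuousOn (fun p : EuclideanSpace ℝ (Fin n) × ℝ =>
      normConst n / (t₀ - p.2) ^ ((n : ℝ) / 4)) Q := by
    simp only [div_eq_mul_inv]
    exact continuousOn_const.mul (hinv _)
  have hB : ContinuousOn (fun p : EuclideanSpace ℝ (Fin n) × ℝ => backwardKernel x₀ t₀ p.1 p.2) Q := by
    refine (hpre.mul fun p hp => ?_).congr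
      fun p hp => backwardKernel_eq x₀ (by linarith [hτ p hp]) p.1
    exact ContinuousAt.comp_continuousWithinAt (g := spaceProfile n) (H _ (hball p hp)).1 (harg p hp)
  have hLB : ContinuousOn (fun p : EuclideanSpace ℝ (Fin n) × ℝ =>
      Laplacian.laplacian (fun y => backwardKernel x₀ t₀ y p.2) p.1) Q := by
    refine ((hpre.mul ((hinv ((1 : ℝ) / 4)).pow 2)).mul fun p hp => ?_).congr
      fun p hp => laplacian_backwardKernel x₀ (by linarith [hτ p hp]) p.1
    exact ContinuousAt.comp_continuousWithinAt (g := Laplacian.laplacian (spaceProfile n))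
      (H _ (hball p hp)).2.1 (harg p hp)
  have hLu := (contDiffOn_laplacian (uniqueDiffOn_Ici 0) hu.smooth).continuousOn.mono hsub
  have hgu := (continuousOn_pd_slice hu).mono hsub
  have hzero : ∀ p ∈ strip n a b \ Q, φ (p.1 - x₀) = 0 := fun p hp => by
    refine hφ.eq_zero _ (not_le.1 fun h => hp.2 ⟨?_, hp.1.2⟩)
    simpa [dist_eq_norm] using h
  have hms : MeasurableSet (strip n a b) := MeasurableSet.univ.prod measurableSet_Icc
  constructor
  · refine IntegrableOn.of_forall_sdiff_eq_zero (s := Q) ?_ hms fun p hp => ?_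
    · exact (((hLu.pow 2).mul hB).mul hφc).integrableOn_compact hQc
    · simp only [laplacianDensity]
      rw [hzero p hp, mul_zero]
  · refine IntegrableOn.of_forall_sdiff_eq_zero (s := Q) ?_ hms fun p hp => ?_
    · exact ((hgu.mul hLB).mul hφc).integrableOn_compact hQc
    · simp only [gradientDensity]
      rw [hzero p hp, mul_zero]

theorem sixteen_mul_pow_le {t₀ R : ℝ} (ht₀ : 0 < t₀) (hR : 0 ≤ R) (h : R ≤ maxRadius t₀) :
    16 * R ^ 4 ≤ t₀ := by
  have h1 : 2 * R ≤ t₀ ^ ((1 : ℝ) / 4) := by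
    have := h.trans (min_le_left _ _)
    linarith
  have h2 : (2 * R) ^ 4 ≤ (t₀ ^ ((1 : ℝ) / 4)) ^ 4 := pow_le_pow_left₀ (by positivity) h1 4
  rw [← Real.rpow_natCast (t₀ ^ ((1 : ℝ) / 4)), ← Real.rpow_mul ht₀.le] at h2
  norm_num at h2
  linarith

theorem layer_subset_strip (t₀ R : ℝ) : layer n t₀ R ⊆ strip n (t₀ - 16 * R ^ 4) (t₀ - R ^ 4) :=
  prod_mono le_rfl Ioo_subset_Icc_self

theorem termsNonneg_of_weight {δ K R₀ r : ℝ} (hδ : 0 ≤ δ) (H : ProfileBounds n δ K)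
    (hK : 0 ≤ K) (hR₀ : 0 < R₀) (hr : r ≤ δ * R₀) {φ : EuclideanSpace ℝ (Fin n) → ℝ}
    (hφ : IsWeight φ r) (x₀ : EuclideanSpace ℝ (Fin n)) {t₀ : ℝ} (ht₀ : 0 < t₀)
    {u : EuclideanSpace ℝ (Fin n) → ℝ → ℝ} (hu : BiheatSol u) :
    TermsNonneg x₀ t₀ u (fun x => φ (x - x₀)) R₀ := by
  intro R hR hRm
  have h16 := sixteen_mul_pow_le ht₀ (hR₀.le.trans hR) hRm
  have hR4 : R₀ ^ 4 ≤ R ^ 4 := pow_le_pow_left₀ hR₀.le hR 4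
  obtain ⟨h1, h2⟩ := integrableOn_strip hδ H hR₀ hr hφ x₀ (t₀ := t₀) (a := t₀ - 16 * R ^ 4)
    (b := t₀ - R ^ 4) (by linarith) (by linarith) hu
  have ht : ∀ p ∈ layer n t₀ R, p.2 ≤ t₀ - R₀ ^ 4 := fun p hp => by linarith [hp.2.2]
  refine ⟨h1.mono_set (layer_subset_strip t₀ R), h2.mono_set (layer_subset_strip t₀ R), ?_, ?_⟩
  · have := setIntegral_nonneg (μ := volume) (measurableSet_layer t₀ R) fun p hp =>
      (laplacianDensity_bounds hδ H hK hR₀ hr hφ x₀ (ht p hp) u p.1).1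
    exact mul_nonneg (by norm_num) this
  · have := setIntegral_nonneg (μ := volume) (measurableSet_layer t₀ R) fun p hp =>
      (gradientDensity_bounds hδ H hK hR₀ hr hφ x₀ (ht p hp) u p.1).1
    rw [integral_neg] at this
    change 0 ≤ -∫ p in layer n t₀ R, gradientDensity x₀ t₀ u (fun x => φ (x - x₀)) p at this
    linarith

/-! ### Almost monotonicity: the contribution of the strip between two radii. -/

/-- The antiderivative is `-4 (t₀ - t)^{1/4}`. This converts a slice bound of order `c^{-3}` into an
error linear in `R₂ - R₁`. -/
theorem integral_quarter_rpow_inv {t₀ R₁ R₂ : ℝ} (h1 : 0 < R₁) (h2 : R₁ ≤ R₂) :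
    IntegrableOn (fun t => 1 / ((t₀ - t) ^ ((1 : ℝ) / 4)) ^ 3)
      (Icc (t₀ - R₂ ^ 4) (t₀ - R₁ ^ 4)) ∧
    ∫ t in Icc (t₀ - R₂ ^ 4) (t₀ - R₁ ^ 4), 1 / ((t₀ - t) ^ ((1 : ℝ) / 4)) ^ 3 =
      4 * (R₂ - R₁) := by
  have h4 : R₁ ^ 4 ≤ R₂ ^ 4 := pow_le_pow_left₀ h1.le h2 4
  have hp : 0 < R₁ ^ 4 := by positivity
  have hc : ContinuousOn (fun t => 1 / ((t₀ - t) ^ ((1 : ℝ) / 4)) ^ 3)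
      (Icc (t₀ - R₂ ^ 4) (t₀ - R₁ ^ 4)) := by
    have h : ContinuousOn (fun t => (t₀ - t) ^ ((1 : ℝ) / 4)) (Icc (t₀ - R₂ ^ 4) (t₀ - R₁ ^ 4)) :=
      ContinuousOn.rpow_const (by fun_prop) fun t ht => Or.inl (by linarith [ht.2])
    exact continuousOn_const.div (h.pow 3) fun t ht =>
      (pow_pos (Real.rpow_pos_of_pos (by linarith [ht.2]) _) 3).ne'
  refine ⟨hc.integrableOn_compact isCompact_Icc, ?_⟩
  have hle : t₀ - R₂ ^ 4 ≤ t₀ - R₁ ^ 4 := by linarith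
  rw [integral_Icc_eq_integral_Ioc, ← intervalIntegral.integral_of_le hle]
  have hderiv : ∀ t ∈ uIcc (t₀ - R₂ ^ 4) (t₀ - R₁ ^ 4),
      HasDerivAt (fun t => -4 * (t₀ - t) ^ ((1 : ℝ) / 4))
        (1 / ((t₀ - t) ^ ((1 : ℝ) / 4)) ^ 3) t := fun t ht => by
    rw [uIcc_of_le hle] at ht
    have hτ : 0 < t₀ - t := by linarith [ht.2]
    have h := (((hasDerivAt_id t).const_sub t₀).rpow_const (p := (1 : ℝ) / 4)
      (Or.inl hτ.ne')).const_mul (-4)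
    refine h.congr_deriv ?_
    rw [← quarter_rpow_pow hτ 3, one_div (_ ^ (((3 : ℕ) : ℝ) / 4)), ← Real.rpow_neg hτ.le]
    simp only [id]
    rw [show ((1 : ℝ) / 4 - 1) = -((3 : ℕ) / 4) by norm_num]
    ring
  rw [intervalIntegral.integral_eq_sub_of_hasDerivAt hderiv
    (hc.mono (by rw [uIcc_of_le hle])).intervalIntegrable]
  have e : ∀ R : ℝ, 0 ≤ R → (t₀ - (t₀ - R ^ 4)) ^ ((1 : ℝ) / 4) = R := fun R hR => by
    rw [sub_sub_cancel, ← Real.rpow_natCast, ← Real.rpow_mul hR]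
    norm_num
  rw [e _ h1.le, e _ (h1.le.trans h2)]
  ring

/-- `κ` measures the cost of replacing `c^{-n}` by `c^{-3}` in the Laplacian term. The gradient term
has no such cost, thanks to the choice of `r`. -/
theorem integral_slice_le (hn : 2 ≤ n) {δ K R₀ r κ : ℝ} (hδ : 0 ≤ δ) (H : ProfileBounds n δ K)
    (hK : 0 ≤ K) (hR₀ : 0 < R₀) (hr0 : 0 < r) (hr : r ≤ δ * R₀) (hr' : r ≤ δ * R₀ ^ (n - 1))
    (hκ : ∀ c : ℝ, R₀ ≤ c → c ≤ 1 → 1 / c ^ n ≤ κ * (1 / c ^ 3))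
    {φ : EuclideanSpace ℝ (Fin n) → ℝ}
    (hφ : IsWeight φ r) (x₀ : EuclideanSpace ℝ (Fin n)) {t₀ t : ℝ} (ht : 0 < t)
    (htt : t ≤ t₀ - R₀ ^ 4) (ht1 : t₀ - 1 ≤ t)
    {u : EuclideanSpace ℝ (Fin n) → ℝ → ℝ} (hu : BiheatSol u) (h : HasL2Bounds u) :
    ∫ x, (1 / 2 * laplacianDensity x₀ t₀ u (fun x => φ (x - x₀)) (x, t) +
        1 / 2 * -gradientDensity x₀ t₀ u (fun x => φ (x - x₀)) (x, t)) ≤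
      normConst n * K * (κ * laplacianEnergy (fun x => u x 0) +
        δ * (gradientEnergy (fun x => u x 0) + laplacianEnergy (fun x => u x 0))) *
        (1 / ((t₀ - t) ^ ((1 : ℝ) / 4)) ^ 3) := by
  have hR4 : 0 < R₀ ^ 4 := by positivity
  have hτ : 0 < t₀ - t := by linarith
  have ha := normConst_pos n
  have hc : R₀ ≤ (t₀ - t) ^ ((1 : ℝ) / 4) := le_quarter_rpow hR₀.le (by linarith)
  have hc1 : (t₀ - t) ^ ((1 : ℝ) / 4) ≤ 1 := quarter_rpow_le zero_le_one hτ.le (by linarith)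
  have hLb := fun x => laplacianDensity_bounds hδ H hK hR₀ hr hφ x₀ htt u x
  have hGb := fun x => gradientDensity_bounds hδ H hK hR₀ hr hφ x₀ htt u x
  set c := (t₀ - t) ^ ((1 : ℝ) / 4) with hcdef
  have hc0 : 0 < c := hR₀.trans_le hc
  have iL : Integrable fun x => Laplacian.laplacian (fun y => u y t) x ^ 2 :=
    integrable_sq_laplacian (hu.slice ht.le) (h.slice 2 (by simp) t ht.le)
  have iG : Integrable fun x => ‖gradient (fun y => u y t) x‖ ^ 2 := by
    simp only [norm_gradient_sq]
    exact integrable_finsetSum _ fun i _ => integrable_sq_of_zero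
      (integrable_sq_pd (hu.slice ht.le) (h.slice 1 (by simp) t ht.le) i)
  have hball : MeasurableSet (Metric.closedBall x₀ r) := Metric.isClosed_closedBall.measurableSet
  have step : ∫ x, (1 / 2 * laplacianDensity x₀ t₀ u (fun x => φ (x - x₀)) (x, t) +
        1 / 2 * -gradientDensity x₀ t₀ u (fun x => φ (x - x₀)) (x, t)) ≤
      ∫ x, (1 / 2 * (normConst n * K / c ^ n * Laplacian.laplacian (fun y => u y t) x ^ 2) +
        1 / 2 * (normConst n * K / c ^ (n + 2) * (Metric.closedBall x₀ r).indicator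
          (fun x => ‖gradient (fun y => u y t) x‖ ^ 2) x)) := by
    refine integral_mono_of_nonneg (.of_forall fun x => ?_) ?_ (.of_forall fun x => ?_)
    · have := (hLb x).1
      have := (hGb x).1
      simp only [Pi.zero_apply]
      positivity
    · exact ((iL.const_mul _).const_mul _).add (((iG.indicator hball).const_mul _).const_mul _)
    · have := (hLb x).2
      have := (hGb x).2
      simp only
      linarith
  refine step.trans ?_
  rw [integral_add ((iL.const_mul _).const_mul _)
    (((iG.indicator hball).const_mul _).const_mul _), integral_const_mul, integral_const_mul,
    integral_const_mul, integral_const_mul, integral_indicator hball]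
  have e1 : ∫ x, Laplacian.laplacian (fun y => u y t) x ^ 2 ≤
      laplacianEnergy (fun x => u x 0) := laplacianEnergy_le hu h ht
  have e2 := setIntegral_ball_gradient_sq_le hn hu h ht x₀ hr0
  set E2 := laplacianEnergy (fun x => u x 0)
  set E1 := gradientEnergy (fun x => u x 0)
  have hE2 : 0 ≤ E2 := integral_nonneg fun x => sq_nonneg _
  have hE1 : 0 ≤ E1 := integral_nonneg fun x => sq_nonneg _
  -- `r ≤ δ R₀^{n-1} ≤ δ c^{n-1}`, and `n + 2 = (n - 1) + 3`.
  have hrc : r * (1 / c ^ (n + 2)) ≤ δ * (1 / c ^ 3) := by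
    have hn1 : n + 2 = (n - 1) + 3 := by omega
    rw [hn1, pow_add, ← one_div_mul_one_div, ← mul_assoc]
    refine mul_le_mul_of_nonneg_right ?_ (by positivity)
    rw [mul_one_div, div_le_iff₀ (by positivity)]
    exact hr'.trans (mul_le_mul_of_nonneg_left (pow_le_pow_left₀ hR₀.le hc _) hδ)
  calc 1 / 2 * (normConst n * K / c ^ n * ∫ x, Laplacian.laplacian (fun y => u y t) x ^ 2) +
      1 / 2 * (normConst n * K / c ^ (n + 2) *
        ∫ x in Metric.closedBall x₀ r, ‖gradient (fun y => u y t) x‖ ^ 2)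
      ≤ 1 / 2 * (normConst n * K / c ^ n * E2) +
      1 / 2 * (normConst n * K / c ^ (n + 2) * (2 * r * (E1 + E2))) := by gcongr
    _ = normConst n * K * (1 / 2 * (1 / c ^ n * E2) + r * (1 / c ^ (n + 2)) * (E1 + E2)) := by ring
    _ ≤ normConst n * K * (1 * (κ * (1 / c ^ 3) * E2) + δ * (1 / c ^ 3) * (E1 + E2)) := by
        have hk := hκ c hc hc1
        gcongr
        norm_num
    _ = _ := by ring

/-- Since the density `g` is non-negative, enlarging `T_{R₁}` to `T_{R₂}` plus a strip only
increases the integral; Fubini and the slice bound then handle the strip. -/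
theorem Psi_le_add (hn : 2 ≤ n) {δ K R₀ r κ : ℝ} (hδ : 0 ≤ δ) (H : ProfileBounds n δ K)
    (hK : 0 ≤ K) (hR₀ : 0 < R₀) (hr0 : 0 < r) (hr : r ≤ δ * R₀) (hr' : r ≤ δ * R₀ ^ (n - 1))
    (hκ : ∀ c : ℝ, R₀ ≤ c → c ≤ 1 → 1 / c ^ n ≤ κ * (1 / c ^ 3))
    {φ : EuclideanSpace ℝ (Fin n) → ℝ}
    (hφ : IsWeight φ r) (x₀ : EuclideanSpace ℝ (Fin n)) {t₀ : ℝ} (ht₀ : 0 < t₀)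
    {u : EuclideanSpace ℝ (Fin n) → ℝ → ℝ} (hu : BiheatSol u) (h : HasL2Bounds u) {R₁ R₂ : ℝ}
    (hR₁ : R₀ ≤ R₁) (hR : R₁ < R₂) (hR₂ : R₂ ≤ maxRadius t₀) :
    Psi x₀ t₀ u R₁ (fun x => φ (x - x₀)) ≤ Psi x₀ t₀ u R₂ (fun x => φ (x - x₀)) +
      normConst n * K * (κ * laplacianEnergy (fun x => u x 0) +
        δ * (gradientEnergy (fun x => u x 0) + laplacianEnergy (fun x => u x 0))) *
        (4 * (R₂ - R₁)) := by
  have p1 : 0 < R₁ := hR₀.trans_le hR₁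
  have p2 : 0 < R₂ := p1.trans hR
  have h16 := sixteen_mul_pow_le ht₀ p2.le hR₂
  have h01 : R₀ ^ 4 ≤ R₁ ^ 4 := pow_le_pow_left₀ hR₀.le hR₁ 4
  have h12 : R₁ ^ 4 < R₂ ^ 4 := pow_lt_pow_left₀ hR p1.le (by simp)
  have h21 : R₂ ^ 4 ≤ 1 := pow_le_one₀ p2.le (hR₂.trans (min_le_right _ _))
  have hq : 0 < R₂ ^ 4 := by positivity
  let g : EuclideanSpace ℝ (Fin n) × ℝ → ℝ := fun p =>
    1 / 2 * laplacianDensity x₀ t₀ u (fun x => φ (x - x₀)) p +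
      1 / 2 * -gradientDensity x₀ t₀ u (fun x => φ (x - x₀)) p
  have hg0 : ∀ p : EuclideanSpace ℝ (Fin n) × ℝ, p.2 ≤ t₀ - R₀ ^ 4 → 0 ≤ g p := fun p hp => by
    have := (laplacianDensity_bounds hδ H hK hR₀ hr hφ x₀ hp u p.1).1
    have := (gradientDensity_bounds hδ H hK hR₀ hr hφ x₀ hp u p.1).1
    simp only [g]
    positivity
  have hgi : ∀ a b, 0 ≤ a → b ≤ t₀ - R₀ ^ 4 → IntegrableOn g (strip n a b) := fun a b ha hb => by
    obtain ⟨h1, h2⟩ := integrableOn_strip hδ H hR₀ hr hφ x₀ ha hb hu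
    exact (h1.const_mul _).add (h2.neg.const_mul _)
  have hPsi : ∀ R, R₀ ≤ R → R ≤ maxRadius t₀ →
      Psi x₀ t₀ u R (fun x => φ (x - x₀)) = ∫ p in layer n t₀ R, g p := fun R hRa hRb => by
    obtain ⟨h1, h2, -, -⟩ := termsNonneg_of_weight hδ H hK hR₀ hr hφ x₀ ht₀ hu R hRa hRb
    have i2 : IntegrableOn (fun p => 1 / 2 * -gradientDensity x₀ t₀ u (fun x => φ (x - x₀)) p)
        (layer n t₀ R) := h2.neg.const_mul (1 / 2)
    simp only [g]
    rw [integral_add (h1.const_mul _) i2, integral_const_mul, integral_const_mul, integral_neg, Psi]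
    ring
  rw [hPsi R₁ hR₁ (hR.le.trans hR₂), hPsi R₂ (hR₁.trans hR.le) hR₂]
  set Z := strip n (t₀ - R₂ ^ 4) (t₀ - R₁ ^ 4) with hZ
  have hms : MeasurableSet Z := MeasurableSet.univ.prod measurableSet_Icc
  -- As `16 R₁⁴ < 16 R₂⁴`, `T_{R₁}` begins after `T_{R₂}` does; the only times it adds are those
  -- from `t₀ - R₂⁴` on.
  have hsub : layer n t₀ R₁ ⊆ layer n t₀ R₂ ∪ Z := fun p hp => by
    obtain ⟨-, ha, hb⟩ := hp
    rcases lt_or_ge p.2 (t₀ - R₂ ^ 4) with hlt | hge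
    · exact Or.inl ⟨mem_univ _, by linarith, hlt⟩
    · exact Or.inr ⟨mem_univ _, hge, hb.le⟩
  have hdisj : Disjoint (layer n t₀ R₂) Z := disjoint_left.2 fun p hp hq =>
    absurd hp.2.2 (not_lt.2 hq.2.1)
  have i2 : IntegrableOn g (layer n t₀ R₂) :=
    (hgi (t₀ - 16 * R₂ ^ 4) (t₀ - R₂ ^ 4) (by linarith) (by linarith)).mono_set
      (layer_subset_strip t₀ R₂)
  have iZ : IntegrableOn g Z := hgi _ _ (by linarith) (by linarith)
  have s1 : ∫ p in layer n t₀ R₁, g p ≤ (∫ p in layer n t₀ R₂, g p) + ∫ p in Z, g p := by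
    rw [← setIntegral_union hdisj hms i2 iZ]
    refine setIntegral_mono_set (i2.union iZ) ?_ hsub.eventuallyLE
    filter_upwards [ae_restrict_mem ((measurableSet_layer t₀ R₂).union hms)] with p hp
    refine hg0 p ?_
    rcases hp with hp | hp
    · linarith [hp.2.2]
    · linarith [hp.2.2]
  refine s1.trans ((add_le_add_iff_left _).2 ?_)
  obtain ⟨iq, eq⟩ := integral_quarter_rpow_inv (t₀ := t₀) p1 hR.le
  rw [← eq, ← integral_const_mul]
  have iZ' := iZ
  rw [hZ, strip, IntegrableOn, Measure.volume_eq_prod, ← Measure.prod_restrict,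
    Measure.restrict_univ] at iZ'
  have e3 : ∫ p in Z, g p = ∫ t in Icc (t₀ - R₂ ^ 4) (t₀ - R₁ ^ 4), ∫ x, g (x, t) := by
    rw [hZ, strip, Measure.volume_eq_prod, ← Measure.prod_restrict, Measure.restrict_univ]
    exact integral_prod_symm _ iZ'
  rw [e3]
  refine setIntegral_mono_on iZ'.integral_prod_right (iq.const_mul _) measurableSet_Icc
    fun t ht => ?_
  exact integral_slice_le hn hδ H hK hR₀ hr0 hr hr' hκ hφ x₀ (by linarith [ht.1])
    (by linarith [ht.2]) (by linarith [ht.1]) hu h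

/-! ### The cut-off function -/

/-- The radius of the support of the cut-off function. -/
def cutoffRadius (n : ℕ) (δ R₀ : ℝ) : ℝ := δ * min R₀ (R₀ ^ (n - 1))

theorem exists_cutoff {r : ℝ} (hr : 0 < r) :
    ∃ φ : EuclideanSpace ℝ (Fin n) → ℝ, IsCutoff φ ∧ IsWeight φ r := by
  let χ : ContDiffBump (0 : EuclideanSpace ℝ (Fin n)) := ⟨r / 2, r, half_pos hr, half_lt_self hr⟩
  refine ⟨χ, ⟨χ.contDiff, χ.hasCompactSupport, fun _ => χ.nonneg, fun _ => χ.le_one,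
    χ.eventuallyEq_one⟩, ⟨χ.continuous, fun _ => χ.nonneg, fun _ => χ.le_one, fun x hx => ?_⟩⟩
  exact χ.zero_of_le_dist (by rw [dist_zero_right]; exact hx.le)

/-- `δ` and `K` are fixed before `R₀`, so `C` depends on `n` alone. All remaining dependence on `R₀`
sits in `κ`, left free so that one statement covers `κ = 1` and `κ = 1/R₀`. -/
theorem exists_cutoff_Psi_le (hn : 2 ≤ n) : ∃ C : ℝ, 0 < C ∧ ∀ R₀ : ℝ, 0 < R₀ →
    ∃ φ : EuclideanSpace ℝ (Fin n) → ℝ, IsCutoff φ ∧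
      ∀ u : EuclideanSpace ℝ (Fin n) → ℝ → ℝ, IsSolution u (Ici 0) → HasL2Bounds u →
      ∀ (x₀ : EuclideanSpace ℝ (Fin n)) (t₀ : ℝ), 0 < t₀ →
        TermsNonneg x₀ t₀ u (fun x => φ (x - x₀)) R₀ ∧
        ∀ κ : ℝ, (∀ c : ℝ, R₀ ≤ c → c ≤ 1 → 1 / c ^ n ≤ κ * (1 / c ^ 3)) → 0 ≤ κ →
        ∀ R₁ R₂ : ℝ, R₀ ≤ R₁ → R₁ < R₂ → R₂ ≤ maxRadius t₀ →
          Psi x₀ t₀ u R₁ (fun x => φ (x - x₀)) ≤ Psi x₀ t₀ u R₂ (fun x => φ (x - x₀)) +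
            C * (R₂ - R₁) * gradientEnergy (fun x => u x 0) +
            C * (κ + 1) * (R₂ - R₁) * laplacianEnergy (fun x => u x 0) := by
  obtain ⟨δ, hδ, K, hK, H⟩ := exists_spaceProfile_bounds hn
  have ha := normConst_pos n
  refine ⟨4 * (normConst n * K * (1 + δ)), by positivity, fun R₀ hR₀ => ?_⟩
  have hr0 : 0 < cutoffRadius n δ R₀ := mul_pos hδ (lt_min hR₀ (by positivity))
  obtain ⟨φ, hφ, hw⟩ := exists_cutoff (n := n) hr0
  -- The first entry of the minimum secures the signs, the second the absorption of powers of `c`;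
  -- which is smaller depends on whether `R₀` exceeds 1.
  have hr : cutoffRadius n δ R₀ ≤ δ * R₀ := mul_le_mul_of_nonneg_left (min_le_left _ _) hδ.le
  have hr' : cutoffRadius n δ R₀ ≤ δ * R₀ ^ (n - 1) :=
    mul_le_mul_of_nonneg_left (min_le_right _ _) hδ.le
  refine ⟨φ, hφ, fun u hu h x₀ t₀ ht₀ =>
    ⟨termsNonneg_of_weight hδ.le H hK.le hR₀ hr hw x₀ ht₀ hu.biheatSol,
    fun κ hκ hκ0 R₁ R₂ h1 h12 h2 => ?_⟩⟩
  have key := Psi_le_add hn hδ.le H hK.le hR₀ hr0 hr hr' hκ hw x₀ ht₀ hu.biheatSol h h1 h12 h2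
  refine key.trans ?_
  have hE2 : 0 ≤ laplacianEnergy (fun x => u x 0) := integral_nonneg fun x => sq_nonneg _
  have hE1 : 0 ≤ gradientEnergy (fun x => u x 0) := integral_nonneg fun x => sq_nonneg _
  set E1 := gradientEnergy (fun x => u x 0)
  set E2 := laplacianEnergy (fun x => u x 0)
  have hD : 0 ≤ R₂ - R₁ := by linarith
  have h3 : κ * E2 + δ * (E1 + E2) ≤ (1 + δ) * (E1 + (κ + 1) * E2) := by
    have q1 : 0 ≤ δ * (κ * E2) := by positivity
    linarith
  have h4 : normConst n * K * (κ * E2 + δ * (E1 + E2)) * (4 * (R₂ - R₁)) ≤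
      normConst n * K * ((1 + δ) * (E1 + (κ + 1) * E2)) * (4 * (R₂ - R₁)) := by gcongr
  linarith

end Biheat

end

/-! ### Assembly of the two dimensional cases. -/

theorem mainTheorem7 :
    (∀ n : ℕ, 2 ≤ n → n ≤ 3 → ∃ C : ℝ, 0 < C ∧ ∀ R₀ : ℝ, 0 < R₀ →
      ∃ φ : EuclideanSpace ℝ (Fin n) → ℝ, Biheat.IsCutoff φ ∧
        ∀ u : EuclideanSpace ℝ (Fin n) → ℝ → ℝ,
          Biheat.IsSolution u (Set.Ici 0) → Biheat.HasL2Bounds u →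
          ∀ (x₀ : EuclideanSpace ℝ (Fin n)) (t₀ : ℝ), 0 < t₀ →
            Biheat.TermsNonneg x₀ t₀ u (fun x => φ (x - x₀)) R₀ ∧
            Biheat.IsPreEntropy x₀ t₀ u (fun x => φ (x - x₀)) R₀ 0 C 1 1
              (1 / 2 * Biheat.laplacianEnergy (fun x => u x 0) +
                (Biheat.gradientEnergy (fun x => u x 0) +
                  Biheat.gradLaplacianEnergy (fun x => u x 0))) ∧
            ∀ R₁ R₂ : ℝ, R₀ ≤ R₁ → R₁ < R₂ → R₂ ≤ min (t₀ ^ ((1 : ℝ) / 4) / 2) 1 →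
              Biheat.Psi x₀ t₀ u R₁ (fun x => φ (x - x₀)) ≤
                Biheat.Psi x₀ t₀ u R₂ (fun x => φ (x - x₀))
                + C * (R₂ ^ 3 - R₁ ^ 3) * Biheat.gradLaplacianEnergy (fun x => u x 0)
                + C * (R₂ - R₁) * Biheat.gradientEnergy (fun x => u x 0)
                + C * (R₂ - R₁) * Biheat.laplacianEnergy (fun x => u x 0)) ∧
    (∃ C : ℝ, 0 < C ∧ ∀ R₀ : ℝ, 0 < R₀ →
      ∃ φ : EuclideanSpace ℝ (Fin 4) → ℝ, Biheat.IsCutoff φ ∧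
        ∀ u : EuclideanSpace ℝ (Fin 4) → ℝ → ℝ,
          Biheat.IsSolution u (Set.Ici 0) → Biheat.HasL2Bounds u →
          ∀ (x₀ : EuclideanSpace ℝ (Fin 4)) (t₀ : ℝ), 0 < t₀ →
            Biheat.TermsNonneg x₀ t₀ u (fun x => φ (x - x₀)) R₀ ∧
            ∀ R₁ R₂ : ℝ, R₀ ≤ R₁ → R₁ < R₂ → R₂ ≤ min (t₀ ^ ((1 : ℝ) / 4) / 2) 1 →
              Biheat.Psi x₀ t₀ u R₁ (fun x => φ (x - x₀)) ≤
                Biheat.Psi x₀ t₀ u R₂ (fun x => φ (x - x₀))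
                + C * (R₂ ^ 2 - R₁ ^ 2) * Biheat.gradLaplacianEnergy (fun x => u x 0)
                + C * (R₂ - R₁) * Biheat.gradientEnergy (fun x => u x 0)
                + C * (1 + 1 / R₀) * (R₂ - R₁) * Biheat.laplacianEnergy (fun x => u x 0)) := by
  have energies : ∀ {n : ℕ} (w : EuclideanSpace ℝ (Fin n) → ℝ), 0 ≤ Biheat.gradientEnergy w ∧
      0 ≤ Biheat.laplacianEnergy w ∧ 0 ≤ Biheat.gradLaplacianEnergy w := fun w =>
    ⟨integral_nonneg fun x => sq_nonneg _, integral_nonneg fun x => sq_nonneg _,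
      integral_nonneg fun x => sq_nonneg _⟩
  constructor
  · intro n hn hn3
    obtain ⟨C, hC, hmain⟩ := Biheat.exists_cutoff_Psi_le hn
    -- With `κ = 1` the Laplacian energy carries the factor `2C`, and `E₀` contains only half of
    -- that energy; hence `4C`.
    refine ⟨4 * C, by positivity, fun R₀ hR₀ => ?_⟩
    obtain ⟨φ, hφ, hΨ⟩ := hmain R₀ hR₀
    refine ⟨φ, hφ, fun u hu hL2 x₀ t₀ ht₀ => ?_⟩
    obtain ⟨hT, hmono⟩ := hΨ u hu hL2 x₀ t₀ ht₀
    obtain ⟨hE1, hE2, hE3⟩ := energies fun x => u x 0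
    have hκ : ∀ c : ℝ, R₀ ≤ c → c ≤ 1 → 1 / c ^ n ≤ 1 * (1 / c ^ 3) := fun c hc hc1 => by
      have hc0 : 0 < c := hR₀.trans_le hc
      rw [one_mul]
      exact one_div_le_one_div_of_le (by positivity) (pow_le_pow_of_le_one hc0.le hc1 hn3)
    have hm := hmono 1 hκ zero_le_one
    refine ⟨hT, ⟨fun R hR hRm => ?_, fun R hR hRm => ?_, fun v hv R hR hRm =>
      hv.hasDerivAt_Psi ht₀ hR hRm, fun R₁ R₂ h1 h12 h2 => ?_⟩, fun R₁ R₂ h1 h12 h2 => ?_⟩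
    · obtain ⟨-, -, a, b⟩ := hT R hR hRm
      unfold Biheat.Psi
      linarith
    · have := Biheat.Psi_scaling x₀ t₀ hR one_ne_zero u fun x => φ (x - x₀)
      rwa [mul_one] at this
    · have h := hm R₁ R₂ h1 h12 h2
      have hD : 0 < R₂ - R₁ := by linarith
      have q1 := mul_nonneg (mul_pos hC hD).le hE1
      have q3 := mul_nonneg (mul_pos hC hD).le hE3
      rw [zero_mul, Real.exp_zero, one_mul, pow_one, pow_one]
      linarith
    · have h := hm R₁ R₂ h1 h12 h2
      have hD : 0 < R₂ - R₁ := by linarith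
      have h3 : R₁ ^ 3 ≤ R₂ ^ 3 := pow_le_pow_left₀ (hR₀.le.trans h1) h12.le 3
      have q1 := mul_nonneg (mul_pos hC hD).le hE1
      have q2 := mul_nonneg (mul_pos hC hD).le hE2
      have q3 := mul_nonneg (mul_nonneg hC.le (sub_nonneg.2 h3)) hE3
      linarith
  · obtain ⟨C, hC, hmain⟩ := Biheat.exists_cutoff_Psi_le (n := 4) (by norm_num)
    refine ⟨C, hC, fun R₀ hR₀ => ?_⟩
    obtain ⟨φ, hφ, hΨ⟩ := hmain R₀ hR₀
    refine ⟨φ, hφ, fun u hu hL2 x₀ t₀ ht₀ => ?_⟩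
    obtain ⟨hT, hmono⟩ := hΨ u hu hL2 x₀ t₀ ht₀
    obtain ⟨-, -, hE3⟩ := energies fun x => u x 0
    -- The surplus factor `1/c` is at most `1/R₀`, so `κ + 1` is exactly the coefficient `1 + 1/R₀`
    -- of the claim.
    have hκ : ∀ c : ℝ, R₀ ≤ c → c ≤ 1 → 1 / c ^ 4 ≤ 1 / R₀ * (1 / c ^ 3) := fun c hc _ => by
      have hc0 : 0 < c := hR₀.trans_le hc
      rw [one_div_mul_one_div]
      refine one_div_le_one_div_of_le (by positivity) ?_
      rw [pow_succ' c 3]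
      gcongr
    refine ⟨hT, fun R₁ R₂ h1 h12 h2 => ?_⟩
    have h := hmono (1 / R₀) hκ (by positivity) R₁ R₂ h1 h12 h2
    have h3 : R₁ ^ 2 ≤ R₂ ^ 2 := pow_le_pow_left₀ (hR₀.le.trans h1) h12.le 2
    have q3 := mul_nonneg (mul_nonneg hC.le (sub_nonneg.2 h3)) hE3
    linarith
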